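/- Let $\Omega\subset\mathbb R^2$ be a bounded, open, strictly convex domain (convex, with no line segment contained in $\partial\Omega$) whose boundary is a closed real-analytic curve with a real-analytic unit speed parametrization $\gamma:\mathbb R/L\mathbb Z\to\partial\Omega$ (bijective). For $c\in\Omega$ and $\xi\in\mathbb R/L\mathbb Z$, let $\gamma(\xi')\neq\gamma(\xi)$ be the point where the ray from $\gamma(\xi)$, obtained by elastic reflection of the segment from $c$ to $\gamma(\xi)$ in the tangent line to $\partial\Omega$ at $\gamma(\xi)$, meets $\partial\Omega$ again, and put $$\varphi_c(\xi)=|\gamma(\xi)-c|+|\gamma(\xi)-\gamma(\xi')|+|\gamma(\xi')-c|.$$ The point $c$ is called focal if $\varphi_c$ is constant. It is said to be of the first kind if the function $\xi\mapsto|\gamma(\xi)-c|$ has strict local extrema (minima or maxima) at two distinct boundary points that are not antipodal, i.e. are not the two endpoints of a chord through $c$; otherwise $c$ is of the second kind. Then $\Omega$ contains at most two focal points of the second kind. If there are exactly two, then $\partial\Omega$ is a non-circular ellipse and these two points are its foci. -/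

import Mathlib

open Set Filter Topology

noncomputable section

namespace Billiard

/-- The Euclidean plane. -/
abbrev Plane : Type := EuclideanSpace ℝ (Fin 2)

/-- A bounded strictly convex open domain of the plane. Strict convexity means that the boundary
contains no segment; it is imposed on the closure, because Mathlib's `StrictConvex` holds for
every open convex set. -/
structure IsStrictlyConvexDomain (Ω : Set Plane) : Prop where
  isOpen : IsOpen Ω
  nonempty : Ω.Nonempty
  isBounded : Bornology.IsBounded Ω
  convex : Convex ℝ Ω
  strictConvex_closure : StrictConvex ℝ (closure Ω)

/-- `γ` is a real-analytic unit speed parametrization of the closed curve `C`, of length `L`, by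
the circle `ℝ / Lℤ`, written as an `L`-periodic function on `ℝ` that is injective on a period. -/
structure IsAnalyticUnitSpeedParam (γ : ℝ → Plane) (L : ℝ) (C : Set Plane) : Prop where
  length_pos : 0 < L
  analytic : AnalyticOnNhd ℝ γ univ
  unit_speed : ∀ ξ, ‖deriv γ ξ‖ = 1
  periodic : Function.Periodic γ L
  injOn : InjOn γ (Ico 0 L)
  range_eq : range γ = C

/-- `ξ` is a strict local extremum (minimum or maximum) of `f`. -/
def IsStrictLocalExtr (f : ℝ → ℝ) (ξ : ℝ) : Prop :=
  (∀ᶠ η in 𝓝[≠] ξ, f ξ < f η) ∨ (∀ᶠ η in 𝓝[≠] ξ, f η < f ξ)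

/-- `p` and `q` are antipodal with respect to `c`: they lie on opposite rays issuing from `c`,
that is, they are the endpoints of a chord through `c`. -/
def Antipodal (c p q : Plane) : Prop := c ∈ openSegment ℝ p q

/-- `c` is of the first kind: the distance `|γ(·) - c|` has a pair of strict local extrema at two
different boundary points that are not antipodal with respect to `c`. -/
def IsFirstKind (γ : ℝ → Plane) (c : Plane) : Prop :=
  ∃ ξ η : ℝ, γ ξ ≠ γ η ∧
    IsStrictLocalExtr (fun s => dist (γ s) c) ξ ∧
    IsStrictLocalExtr (fun s => dist (γ s) c) η ∧
    ¬ Antipodal c (γ ξ) (γ η)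

/-- `c` is of the second kind: it is not of the first kind. -/
def IsSecondKind (γ : ℝ → Plane) (c : Plane) : Prop := ¬ IsFirstKind γ c

/-- The segment from `c` to `γ ξ` is elastically reflected at `γ ξ` into the segment from `γ ξ` to
`γ η`: the outgoing direction is the mirror image, in the tangent line at `γ ξ`, of the incoming
one. -/
def ReflectsInto (γ : ℝ → Plane) (c : Plane) (ξ η : ℝ) : Prop :=
  ∃ t : ℝ, 0 < t ∧
    γ η - γ ξ = t • (Submodule.span ℝ {deriv γ ξ}).reflection (γ ξ - c)

/-- The perimeter of the triangle with vertices `c`, `γ ξ`, `γ η`. -/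
def perimeter (γ : ℝ → Plane) (c : Plane) (ξ η : ℝ) : ℝ :=
  dist (γ ξ) c + dist (γ ξ) (γ η) + dist (γ η) c

/-- `c` is a focal point: the function `φ_c`, whose value at `ξ` is the perimeter of the triangle
`c, γ ξ, γ ξ'` where the segment from `c` to `γ ξ` reflects into the one from `γ ξ` to `γ ξ'`, is
constant. For `c` inside a strictly convex domain bounded by `γ`, the point `γ ξ'` exists and is
unique. -/
def IsFocal (γ : ℝ → Plane) (c : Plane) : Prop :=
  ∃ M : ℝ, ∀ ξ : ℝ, ∃ ξ' : ℝ, ReflectsInto γ c ξ ξ' ∧ perimeter γ c ξ ξ' = M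

/-- The set of focal points of the second kind of the domain `Ω` with boundary curve `γ`. -/
def focalPointsSecondKind (Ω : Set Plane) (γ : ℝ → Plane) : Set Plane :=
  {c | c ∈ Ω ∧ IsFocal γ c ∧ IsSecondKind γ c}

/-- `E` is the (nondegenerate) ellipse with foci `f₁`, `f₂` and major axis of some length
`ℓ > |f₁ - f₂|`. It is a circle exactly when `f₁ = f₂`. -/
def IsEllipseWithFoci (E : Set Plane) (f₁ f₂ : Plane) : Prop :=
  ∃ ℓ : ℝ, dist f₁ f₂ < ℓ ∧ E = {x | dist x f₁ + dist x f₂ = ℓ}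

end Billiard

end

/-! Constancy of `φ_c` forces the reflection law at the second boundary point too
(`IsFocal.tang_add_tang`): otherwise implicit differentiation freezes `ξ'` locally, and analytic
continuation of a constant sum of distances gives a contradiction. So every billiard ray from a
focal point returns to it after two reflections, and the line through two focal points must be a
double normal (`exists_isDoubleNormal`).

Let `ℓ` be the length of that double normal, `κ` the curvature at its end `γ α`, and let `c`, `c'`
divide it in the ratios `k`, `k'` measured from `γ α`. Linearizing both reflection laws gives a
quadratic equation satisfied by `k` and `k'`. By Vieta, either both radii of curvature equal `ℓ`, or
`1/k + 1/k' = 2ℓκ`. In the first case the distance to `c` has strict minima at both ends and a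
maximum elsewhere, so `c` is of the first kind. For `c` of the second kind, `c'` is therefore the
conjugate of `c`, and both ends are strict extrema (`IsSecondKind.conjugate`). Another focal point
would give another chord of extrema through `c`; second kind forces the chords to coincide, and
conjugates are unique (`not_three_focal`).

Given two such points, let `D` be the derivative of `|γ - c| + |γ - c'|`. Both reflection maps
multiply `D` by explicit factors (`IsFocal.exists_scaling`). Their composition fixes `α`, and its
multiplier has absolute value different from `1` and is, in absolute value, inverse to the factor of
`D`. Comparing orders of vanishing gives `D = 0` near `α` (`eventually_eq_zero_of_scaling`), hence
everywhere by analyticity, and the boundary is an ellipse. -/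

namespace Billiard

/-! ### Chords and rays of a strictly convex domain -/

section Convex

variable {Ω : Set Plane}

theorem IsStrictlyConvexDomain.interior_closure (hΩ : IsStrictlyConvexDomain Ω) :
    interior (closure Ω) = Ω := by
  rw [hΩ.convex.interior_closure_eq_interior_of_nonempty_interior
    (by rw [hΩ.isOpen.interior_eq]; exact hΩ.nonempty), hΩ.isOpen.interior_eq]

theorem IsStrictlyConvexDomain.notMem_of_mem_frontier (hΩ : IsStrictlyConvexDomain Ω) {p : Plane}
    (hp : p ∈ frontier Ω) : p ∉ Ω := by
  rw [frontier, hΩ.isOpen.interior_eq] at hp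
  exact hp.2

theorem IsStrictlyConvexDomain.openSegment_subset (hΩ : IsStrictlyConvexDomain Ω) {p q : Plane}
    (hp : p ∈ closure Ω) (hq : q ∈ closure Ω) (h : p ≠ q) : openSegment ℝ p q ⊆ Ω := by
  rw [openSegment_subset_iff]
  intro a b ha hb hab
  have := hΩ.strictConvex_closure hp hq h ha hb hab
  rwa [hΩ.interior_closure] at this

theorem add_smul_mem_openSegment {p w : Plane} {s t : ℝ} (hs : 0 < s) (hst : s < t) :
    p + s • w ∈ openSegment ℝ p (p + t • w) := by
  have ht : 0 < t := hs.trans hst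
  refine ⟨1 - s / t, s / t, ?_, by positivity, by ring, ?_⟩
  · rw [sub_pos, div_lt_one ht]; exact hst
  · rw [smul_add, smul_smul, div_mul_cancel₀ _ ht.ne', ← add_assoc, ← add_smul]
    simp

theorem IsStrictlyConvexDomain.ray_unique (hΩ : IsStrictlyConvexDomain Ω) {p w : Plane} {s t : ℝ}
    (hp : p ∈ frontier Ω) (hs : 0 < s) (ht : 0 < t) (hw : w ≠ 0) (h1 : p + s • w ∈ frontier Ω)
    (h2 : p + t • w ∈ frontier Ω) : s = t := by
  have key : ∀ s t : ℝ, 0 < s → p + s • w ∈ frontier Ω → p + t • w ∈ frontier Ω → ¬ s < t := by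
    intro s t hs h1 h2 hst
    refine hΩ.notMem_of_mem_frontier h1 (hΩ.openSegment_subset (frontier_subset_closure hp)
      (frontier_subset_closure h2) ?_ (add_smul_mem_openSegment hs hst))
    simp [hw, (hs.trans hst).ne']
  exact le_antisymm (not_lt.1 (key t s ht h2 h1)) (not_lt.1 (key s t hs h1 h2))

/-- The parameter at which a ray issuing from a boundary point meets the boundary again depends
continuously on the ray. -/
theorem IsStrictlyConvexDomain.continuousAt_ray (hΩ : IsStrictlyConvexDomain Ω)
    {p w : ℝ → Plane} {t : ℝ → ℝ} {x : ℝ} (hp : ContinuousAt p x) (hw : ContinuousAt w x)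
    (hw0 : w x ≠ 0) (ht : ∀ s, 0 < t s) (hpf : ∀ s, p s ∈ frontier Ω)
    (hqf : ∀ s, p s + t s • w s ∈ frontier Ω) : ContinuousAt t x := by
  have hne : ∀ a : ℝ, 0 < a → p x ≠ p x + a • w x := by
    intro a ha; simp [hw0, ha.ne']
  have hpc := fun s => frontier_subset_closure (hpf s)
  have hqc := fun s => frontier_subset_closure (hqf s)
  refine tendsto_order.2 ⟨fun a ha => ?_, fun a ha => ?_⟩
  -- Lower bound: the point at parameter `a` is interior and stays so for nearby rays, which
  -- therefore cannot have left the domain before it.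
  · by_cases ha0 : 0 < a
    · have hin : p x + a • w x ∈ Ω := hΩ.openSegment_subset (hpc x) (hqc x) (hne _ (ht x))
        (add_smul_mem_openSegment ha0 ha)
      have hc : ContinuousAt (fun s => p s + a • w s) x := hp.add (hw.const_smul a)
      filter_upwards [hc.eventually (hΩ.isOpen.mem_nhds hin)] with s hs
      by_contra hle
      rcases (not_lt.1 hle).lt_or_eq with h | h
      · refine hΩ.notMem_of_mem_frontier (hqf s) ?_
        have := hΩ.convex.openSegment_closure_interior_subset_interior (hpc s)
          (by rwa [hΩ.isOpen.interior_eq] : p s + a • w s ∈ interior Ω)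
        rw [hΩ.isOpen.interior_eq] at this
        exact this (add_smul_mem_openSegment (ht s) h)
      · exact hΩ.notMem_of_mem_frontier (hqf s) (h ▸ hs)
    · exact Eventually.of_forall fun s => (not_lt.1 ha0).trans_lt (ht s)
  -- Upper bound: beyond the exit point the ray is outside the closed domain, an open condition.
  · have hout : p x + a • w x ∉ closure Ω := by
      intro h
      exact hΩ.notMem_of_mem_frontier (hqf x) (hΩ.openSegment_subset (hpc x) h
        (hne _ ((ht x).trans ha)) (add_smul_mem_openSegment (ht x) ha))
    have hc : ContinuousAt (fun s => p s + a • w s) x := hp.add (hw.const_smul a)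
    filter_upwards [hc.eventually (isClosed_closure.isOpen_compl.mem_nhds hout)] with s hs
    by_contra hle
    rcases (not_lt.1 hle).lt_or_eq with h | h
    · exact hs (hΩ.convex.closure.openSegment_subset (hpc s) (hqc s)
        (add_smul_mem_openSegment ((ht x).trans ha) h))
    · exact hs (h ▸ hqc s)

theorem IsStrictlyConvexDomain.exists_frontier_ray (hΩ : IsStrictlyConvexDomain Ω) {c w : Plane}
    (hc : c ∈ Ω) (hw : w ≠ 0) : ∃ t : ℝ, 0 < t ∧ c + t • w ∈ frontier Ω := by
  by_contra hcon
  push Not at hcon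
  -- A connected ray that never meets the boundary would stay in `Ω`, against boundedness.
  have hpre : IsPreconnected ((fun t : ℝ => c + t • w) '' Ici 0) :=
    isPreconnected_Ici.image _ (by fun_prop)
  have hsub : (fun t : ℝ => c + t • w) '' Ici 0 ⊆ Ω := by
    by_contra hns
    refine (isPreconnected_iff_subset_of_disjoint.1 hpre Ω (closure Ω)ᶜ
        hΩ.isOpen isClosed_closure.isOpen_compl ?_ ?_).elim hns
          (fun h => h ⟨0, by simp, by simp⟩ (subset_closure hc))
    · rintro _ ⟨t, ht, rfl⟩
      by_cases h : c + t • w ∈ Ω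
      · exact Or.inl h
      · refine Or.inr fun h' => ?_
        have hf : c + t • w ∈ frontier Ω := ⟨h', by rwa [hΩ.isOpen.interior_eq]⟩
        rcases (show (0 : ℝ) ≤ t from ht).lt_or_eq with h0 | h0
        · exact hcon t h0 hf
        · subst h0; simp [hc] at h
    · ext x
      simp only [mem_inter_iff, mem_compl_iff, mem_empty_iff_false, iff_false]
      rintro ⟨-, h1, h2⟩
      exact h2 (subset_closure h1)
  obtain ⟨R, hR⟩ := hΩ.isBounded.exists_norm_le
  have hwn : 0 < ‖w‖ := norm_pos_iff.2 hw
  have h0 : 0 ≤ (R + 1 + ‖c‖) / ‖w‖ := by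
    have := (norm_nonneg c).trans (hR c hc); positivity
  have h1 := hR _ (hsub ⟨(R + 1 + ‖c‖) / ‖w‖, h0, rfl⟩)
  have h2 := norm_sub_le (c + ((R + 1 + ‖c‖) / ‖w‖) • w) c
  rw [add_sub_cancel_left, norm_smul, Real.norm_of_nonneg h0, div_mul_cancel₀ _ hwn.ne'] at h2
  linarith

end Convex

/-! ### Local lifts along the parametrization -/

section Lift

variable {γ : ℝ → Plane} {L : ℝ} {C : Set Plane}

theorem IsAnalyticUnitSpeedParam.eq_of_mem_Ico (hγ : IsAnalyticUnitSpeedParam γ L C) (a : ℝ)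
    {s t : ℝ} (hs : s ∈ Ico a (a + L)) (ht : t ∈ Ico a (a + L)) (h : γ s = γ t) : s = t := by
  have hm : ∀ s, γ (toIcoMod hγ.length_pos 0 s) = γ s := by
    intro s
    rw [toIcoMod]
    exact hγ.periodic.sub_zsmul_eq _
  have h2 : toIcoMod hγ.length_pos 0 s = toIcoMod hγ.length_pos 0 t := by
    refine hγ.injOn ?_ ?_ (by rw [hm, hm, h])
    · simpa using toIcoMod_mem_Ico hγ.length_pos 0 s
    · simpa using toIcoMod_mem_Ico hγ.length_pos 0 t
  rw [toIcoMod, toIcoMod, zsmul_eq_mul, zsmul_eq_mul] at h2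
  set m := toIcoDiv hγ.length_pos 0 s
  set n := toIcoDiv hγ.length_pos 0 t
  have h3 : s - t = ((m - n : ℤ) : ℝ) * L := by push_cast; linarith
  have hL := hγ.length_pos
  have h4 : m - n = 0 := by
    have h5 : ((m - n : ℤ) : ℝ) < 1 := by
      by_contra hc
      have : L ≤ ((m - n : ℤ) : ℝ) * L := le_mul_of_one_le_left hL.le (not_lt.1 hc)
      linarith [hs.2, ht.1]
    have h6 : (-1 : ℝ) < ((m - n : ℤ) : ℝ) := by
      by_contra hc
      have : ((m - n : ℤ) : ℝ) * L ≤ -1 * L := mul_le_mul_of_nonneg_right (not_lt.1 hc) hL.le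
      linarith [hs.1, ht.2]
    have h7 : m - n < 1 := by exact_mod_cast h5
    have h8 : -1 < m - n := by exact_mod_cast h6
    omega
  rw [h4] at h3
  simp at h3
  linarith

theorem IsAnalyticUnitSpeedParam.exists_eq_mem_Ico (hγ : IsAnalyticUnitSpeedParam γ L C) (a s : ℝ) :
    ∃ t ∈ Ico a (a + L), γ t = γ s := by
  refine ⟨toIcoMod hγ.length_pos a s, toIcoMod_mem_Ico hγ.length_pos a s, ?_⟩
  rw [toIcoMod]
  exact hγ.periodic.sub_zsmul_eq _

theorem IsAnalyticUnitSpeedParam.continuous (hγ : IsAnalyticUnitSpeedParam γ L C) :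
    Continuous γ :=
  continuousOn_univ.1 hγ.analytic.continuousOn

/-- A function into one period is continuous where its composition with `γ` is. -/
theorem IsAnalyticUnitSpeedParam.continuousAt_of_comp (hγ : IsAnalyticUnitSpeedParam γ L C)
    {a : ℝ} {f : ℝ → ℝ} {x : ℝ} (hf : ∀ s, f s ∈ Ico a (a + L)) (hfx : f x ∈ Ioo a (a + L))
    (hc : ContinuousAt (fun s => γ (f s)) x) : ContinuousAt f x := by
  intro V hV
  obtain ⟨U, hUV, hUo, hxU⟩ := mem_nhds_iff.1 hV
  have hK : IsCompact (Icc a (a + L) \ U) := isCompact_Icc.diff hUo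
  have hKc : IsClosed (γ '' (Icc a (a + L) \ U)) := (hK.image hγ.continuous).isClosed
  have hn : γ (f x) ∉ γ '' (Icc a (a + L) \ U) := by
    rintro ⟨t, ⟨ht, htU⟩, hte⟩
    -- Compactness needs the closed period; its extra endpoint has the same image as `a`, excluded
    -- because `f x` is interior.
    rcases ht.2.lt_or_eq with h | h
    · exact htU (hγ.eq_of_mem_Ico a ⟨ht.1, h⟩ (hf x) hte ▸ hxU)
    · have h1 : γ a = γ (f x) := by rw [← hte, h, hγ.periodic]
      have := hγ.eq_of_mem_Ico a ⟨le_rfl, by linarith [hγ.length_pos]⟩ (hf x) h1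
      exact absurd hfx.1 (by simp [← this])
  rw [mem_map]
  filter_upwards [hc.eventually (hKc.isOpen_compl.mem_nhds hn)] with s hs
  by_contra hsV
  exact hs ⟨f s, ⟨Ico_subset_Icc_self (hf s), fun h => hsV (hUV h)⟩, rfl⟩

end Lift

end Billiard

namespace Billiard

/-! ### Implicit differentiation -/

/-- Since continuity of the solution `σ` is given, differentiability of `G` at the single point
suffices; no continuous differentiability is needed. -/
theorem hasDerivAt_of_implicit {G : ℝ × ℝ → ℝ} {σ : ℝ → ℝ} {x y a b : ℝ}
    (hG : DifferentiableAt ℝ G (x, y)) (ha : HasDerivAt (fun s => G (s, y)) a x)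
    (hb : HasDerivAt (fun q => G (x, q)) b y) (hb0 : b ≠ 0) (hσ : ContinuousAt σ x)
    (hy : σ x = y) (h0 : ∀ᶠ s in 𝓝 x, G (s, σ s) = G (x, y)) :
    HasDerivAt σ (-a / b) x := by
  obtain ⟨A, hA⟩ := hG
  have h10 : A (1, 0) = a := by
    have h1 : HasDerivAt (fun s : ℝ => (s, y)) ((1 : ℝ), (0 : ℝ)) x :=
      (hasDerivAt_id x).prodMk (hasDerivAt_const x y)
    exact (HasFDerivAt.comp_hasDerivAt x (f := fun s : ℝ => (s, y)) hA h1).unique ha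
  have h01 : A (0, 1) = b := by
    have h1 : HasDerivAt (fun q : ℝ => (x, q)) ((0 : ℝ), (1 : ℝ)) y :=
      (hasDerivAt_const y x).prodMk (hasDerivAt_id y)
    exact (HasFDerivAt.comp_hasDerivAt y (f := fun q : ℝ => (x, q)) hA h1).unique hb
  have hAv : ∀ u v : ℝ, A (u, v) = a * u + b * v := by
    intro u v
    have : ((u, v) : ℝ × ℝ) = u • ((1 : ℝ), (0 : ℝ)) + v • ((0 : ℝ), (1 : ℝ)) := by simp
    rw [this, map_add, map_smul, map_smul, h10, h01, smul_eq_mul, smul_eq_mul]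
    ring
  have htend : Tendsto (fun s => (s, σ s)) (𝓝 x) (𝓝 (x, y)) := by
    have := (continuousAt_id (x := x)).prodMk hσ
    rw [ContinuousAt, hy] at this
    exact this
  rw [hasDerivAt_iff_isLittleO, Asymptotics.isLittleO_iff]
  intro c hc
  set K := 1 + |a / b| with hK
  have hK1 : 1 ≤ K := by rw [hK]; linarith [abs_nonneg (a / b)]
  have hbp : 0 < |b| := abs_pos.2 hb0
  -- The bound `1 / 2` lets the error `|E|` be absorbed on the left; `c / (2 * K)` leaves at most `c
  -- * |s - x|`.
  set e := min (1 / 2) (c / (2 * K)) with he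
  have he0 : 0 < e := lt_min (by norm_num) (by positivity)
  have hlo := (hasFDerivAt_iff_isLittleO.1 hA).comp_tendsto htend
  have := (Asymptotics.isLittleO_iff.1 hlo) (mul_pos hbp he0)
  filter_upwards [this, h0] with s hs hs0
  simp only [Function.comp_apply, hs0, sub_self, zero_sub, norm_neg, Prod.mk_sub_mk, hAv,
    Prod.norm_mk, Real.norm_eq_abs] at hs
  rw [hy, Real.norm_eq_abs, Real.norm_eq_abs, smul_eq_mul]
  set E := σ s - y - (s - x) * (-a / b) with hE
  have h1 : a * (s - x) + b * (σ s - y) = b * E := by rw [hE]; field_simp; ring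
  rw [h1, abs_mul, mul_assoc] at hs
  have h2 : |E| ≤ e * max |s - x| |σ s - y| := le_of_mul_le_mul_left hs hbp
  have h3 : |σ s - y| ≤ |E| + |a / b| * |s - x| := by
    have : σ s - y = E + -(a / b) * (s - x) := by rw [hE]; ring
    rw [this]
    refine (abs_add_le _ _).trans (by rw [abs_mul, abs_neg])
  have h4 : max |s - x| |σ s - y| ≤ |E| + K * |s - x| := by
    refine max_le ?_ ?_
    · nlinarith [abs_nonneg E, abs_nonneg (s - x)]
    · rw [hK]; nlinarith [abs_nonneg (s - x)]
  have h5 : |E| ≤ 1 / 2 * |E| + e * K * |s - x| := by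
    calc |E| ≤ e * (|E| + K * |s - x|) := h2.trans (by gcongr)
      _ = e * |E| + e * K * |s - x| := by ring
      _ ≤ _ := by gcongr; exact min_le_left _ _
  have h6 : e * K ≤ c / 2 := by
    calc e * K ≤ c / (2 * K) * K := by gcongr; exact min_le_right _ _
      _ = c / 2 := by field_simp
  nlinarith [abs_nonneg (s - x)]

/-! ### The tangential component of the direction from a point to the curve -/

/-- The component, along the tangent at `γ s`, of the unit vector pointing from `X` to `γ s`. -/
noncomputable def tang (γ : ℝ → Plane) (X : Plane) (s : ℝ) : ℝ :=
  inner ℝ (γ s - X) (deriv γ s) / dist (γ s) X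

section Param

variable {γ : ℝ → Plane} {L : ℝ} {C : Set Plane}

theorem IsAnalyticUnitSpeedParam.hasDerivAt (hγ : IsAnalyticUnitSpeedParam γ L C) (s : ℝ) :
    HasDerivAt γ (deriv γ s) s :=
  (hγ.analytic s (mem_univ s)).differentiableAt.hasDerivAt

theorem IsAnalyticUnitSpeedParam.hasDerivAt_deriv (hγ : IsAnalyticUnitSpeedParam γ L C) (s : ℝ) :
    HasDerivAt (deriv γ) (deriv (deriv γ) s) s :=
  (hγ.analytic s (mem_univ s)).deriv.differentiableAt.hasDerivAt

theorem hasDerivAt_dist_curve {f : ℝ → Plane} {f' X : Plane} {s : ℝ} (hf : HasDerivAt f f' s)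
    (h : f s ≠ X) :
    HasDerivAt (fun s => dist (f s) X) (inner ℝ (f s - X) f' / dist (f s) X) s := by
  have h1 := (hf.sub_const X).norm_sq.sqrt (by
    have := norm_pos_iff.2 (sub_ne_zero.2 h); positivity)
  simp only [← dist_eq_norm, Real.sqrt_sq dist_nonneg] at h1
  rwa [mul_div_mul_left _ _ two_ne_zero] at h1

theorem IsAnalyticUnitSpeedParam.hasDerivAt_dist (hγ : IsAnalyticUnitSpeedParam γ L C) {X : Plane}
    {s : ℝ} (h : γ s ≠ X) : HasDerivAt (fun s => dist (γ s) X) (tang γ X s) s :=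
  hasDerivAt_dist_curve (hγ.hasDerivAt s) h

theorem IsAnalyticUnitSpeedParam.analyticAt_dist (hγ : IsAnalyticUnitSpeedParam γ L C) {X : Plane}
    {s : ℝ} (h : γ s ≠ X) : AnalyticAt ℝ (fun s => dist (γ s) X) s := by
  exact ((hγ.analytic s (mem_univ s)).contDiffAt.dist ℝ contDiffAt_const h).analyticAt

/-- At a reflection point the tangential components of both rays cancel. -/
theorem ReflectsInto.tang_add_tang (hγ : IsAnalyticUnitSpeedParam γ L C) {c : Plane} {ξ η : ℝ}
    (h : ReflectsInto γ c ξ η) : tang γ c ξ + tang γ (γ η) ξ = 0 := by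
  obtain ⟨t, ht, h⟩ := h
  have h1 : dist (γ ξ) (γ η) = t * dist (γ ξ) c := by
    rw [dist_comm, dist_eq_norm, h, norm_smul, LinearIsometryEquiv.norm_map, Real.norm_of_nonneg ht.le,
      dist_eq_norm]
  have h2 : inner ℝ (γ ξ - γ η) (deriv γ ξ) = - (t * inner ℝ (γ ξ - c) (deriv γ ξ)) := by
    rw [← neg_sub, h, inner_neg_left, inner_smul_left, Submodule.reflection_singleton_apply,
      inner_sub_left, two_smul, inner_add_left, inner_smul_left, real_inner_self_eq_norm_sq,
      hγ.unit_speed, real_inner_comm]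
    simp
  rw [tang, tang, h1, h2, neg_div, mul_div_mul_left _ _ ht.ne', add_neg_cancel]

theorem IsAnalyticUnitSpeedParam.mem (hγ : IsAnalyticUnitSpeedParam γ L C) (s : ℝ) : γ s ∈ C :=
  hγ.range_eq ▸ mem_range_self s

end Param

section Domain

variable {Ω : Set Plane} {γ : ℝ → Plane} {L : ℝ}

theorem ne_of_mem_domain (hΩ : IsStrictlyConvexDomain Ω)
    (hγ : IsAnalyticUnitSpeedParam γ L (frontier Ω)) {c : Plane} (hc : c ∈ Ω) (s : ℝ) :
    γ s ≠ c := fun h => hΩ.notMem_of_mem_frontier (hγ.mem s) (h ▸ hc)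

theorem ReflectsInto.ne (hΩ : IsStrictlyConvexDomain Ω)
    (hγ : IsAnalyticUnitSpeedParam γ L (frontier Ω)) {c : Plane} (hc : c ∈ Ω) {ξ η : ℝ}
    (h : ReflectsInto γ c ξ η) : γ ξ ≠ γ η := by
  obtain ⟨t, ht, h⟩ := h
  intro he
  rw [he, sub_self, eq_comm, smul_eq_zero, LinearIsometryEquiv.map_eq_zero_iff, ← he,
    sub_eq_zero] at h
  exact h.elim ht.ne' (ne_of_mem_domain hΩ hγ hc ξ)

theorem ReflectsInto.eq (hΩ : IsStrictlyConvexDomain Ω)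
    (hγ : IsAnalyticUnitSpeedParam γ L (frontier Ω)) {c : Plane} (hc : c ∈ Ω) {ξ η η' : ℝ}
    (h : ReflectsInto γ c ξ η) (h' : ReflectsInto γ c ξ η') : γ η = γ η' := by
  obtain ⟨t, ht, h⟩ := h
  obtain ⟨t', ht', h'⟩ := h'
  rw [sub_eq_iff_eq_add'] at h h'
  rw [h, h', hΩ.ray_unique (hγ.mem ξ) ht ht' _ (h ▸ hγ.mem η) (h' ▸ hγ.mem η')]
  rw [Ne, LinearIsometryEquiv.map_eq_zero_iff, sub_eq_zero]
  exact ne_of_mem_domain hΩ hγ hc ξ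

theorem ReflectsInto.congr_right {c : Plane} {ξ η η' : ℝ} (h : ReflectsInto γ c ξ η)
    (he : γ η = γ η') : ReflectsInto γ c ξ η' := by
  rwa [ReflectsInto, he] at h

/-- A focal point comes with a local continuous determination of the reflected point. -/
theorem IsFocal.exists_lift (hΩ : IsStrictlyConvexDomain Ω)
    (hγ : IsAnalyticUnitSpeedParam γ L (frontier Ω)) {c : Plane} (hc : c ∈ Ω) (hf : IsFocal γ c)
    {ξ η : ℝ} (h : ReflectsInto γ c ξ η) :
    ∃ (σ : ℝ → ℝ) (M : ℝ), σ ξ = η ∧ (∀ᶠ s in 𝓝 ξ, ContinuousAt σ s) ∧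
      ∀ s, ReflectsInto γ c s (σ s) ∧ perimeter γ c s (σ s) = M := by
  obtain ⟨M, hM⟩ := hf
  choose τ hτ hτM using hM
  -- The period is centred at `η`, so that the lift stays off its endpoints near `ξ` and is
  -- continuous there.
  choose σ hσI hσ using fun s => hγ.exists_eq_mem_Ico (η - L / 2) (τ s)
  have hL := hγ.length_pos
  have hσr : ∀ s, ReflectsInto γ c s (σ s) := fun s => (hτ s).congr_right (hσ s).symm
  have hσM : ∀ s, perimeter γ c s (σ s) = M := fun s => by
    rw [perimeter, hσ s]; exact hτM s
  have hcont : ∀ s, ContinuousAt (fun s => γ (σ s)) s := by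
    intro s
    choose t ht htσ using hσr
    simp only [sub_eq_iff_eq_add'] at htσ
    have hw : Continuous
        fun s => (Submodule.span ℝ {deriv γ s}).reflection (γ s - c) := by
      simp only [Submodule.reflection_singleton_apply, hγ.unit_speed]
      have h1 : Continuous (deriv γ) :=
        continuous_iff_continuousAt.2 fun s => (hγ.hasDerivAt_deriv s).continuousAt
      have h2 := hγ.continuous
      fun_prop
    have ht' : ContinuousAt t s := hΩ.continuousAt_ray hγ.continuous.continuousAt hw.continuousAt
      (by
        rw [Ne, LinearIsometryEquiv.map_eq_zero_iff, sub_eq_zero]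
        exact ne_of_mem_domain hΩ hγ hc s) ht hγ.mem (fun s => htσ s ▸ hγ.mem (σ s))
    simp only [htσ]
    exact hγ.continuous.continuousAt.add (ht'.smul hw.continuousAt)
  have hση : σ ξ = η := hγ.eq_of_mem_Ico (η - L / 2) (hσI ξ) ⟨by linarith, by linarith⟩
    ((hσr ξ).eq hΩ hγ hc h)
  have hc0 : ContinuousAt σ ξ := hγ.continuousAt_of_comp hσI
    (by rw [hση]; constructor <;> linarith) (hcont ξ)
  refine ⟨σ, M, hση, ?_, fun s => ⟨hσr s, hσM s⟩⟩
  have hI : Ioo (η - L / 2) (η - L / 2 + L) ∈ 𝓝 (σ ξ) := by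
    rw [hση]; exact Ioo_mem_nhds (by linarith) (by linarith)
  filter_upwards [hc0.eventually hI] with s hs
  exact hγ.continuousAt_of_comp hσI hs (hcont s)

end Domain

end Billiard

namespace Billiard

/-! ### Directions determined by their tangential component -/

section Direction

variable {γ : ℝ → Plane}

theorem tang_eq_of_smul {X Y : Plane} {s k : ℝ} (hk : 0 < k) (h : γ s - Y = k • (γ s - X)) :
    tang γ Y s = tang γ X s := by
  rw [tang, tang, dist_eq_norm, h, dist_eq_norm, norm_smul, inner_smul_left, Real.norm_of_nonneg hk.le]
  simp only [conj_trivial]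
  rw [mul_div_mul_left _ _ hk.ne']

theorem exists_smul_of_mem_openSegment {p q x : Plane} (h : x ∈ openSegment ℝ p q) :
    ∃ k : ℝ, 0 < k ∧ k < 1 ∧ p - x = k • (p - q) ∧ q - x = (1 - k) • (q - p) := by
  obtain ⟨a, b, ha, hb, hab, rfl⟩ := h
  obtain rfl : a = 1 - b := by linarith
  refine ⟨b, hb, by linarith, ?_, ?_⟩ <;> module

theorem mem_openSegment_of_smul {c w : Plane} {x r t : ℝ} (h1 : r < x) (h2 : x < t) :
    c + x • w ∈ openSegment ℝ (c + t • w) (c + r • w) := by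
  have h : 0 < t - r := by linarith
  refine ⟨(x - r) / (t - r), (t - x) / (t - r), div_pos (by linarith) h, div_pos (by linarith) h,
    ?_, ?_⟩
  · rw [← add_div]
    exact (div_eq_one_iff_eq h.ne').2 (by ring)
  · have e1 : (x - r) / (t - r) = 1 - (t - x) / (t - r) := by field_simp; ring
    have e2 : x = t - (t - x) / (t - r) * (t - r) := by field_simp; ring
    rw [e1]
    conv_rhs => rw [e2]
    module

/-- Two unit vectors with the same tangential component, on the same side, are equal. -/
theorem eq_of_inner_eq {u v T n : Plane} (hu : ‖u‖ = 1) (hv : ‖v‖ = 1) (hT : ‖T‖ = 1)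
    (hn : n ≠ 0) (hnT : inner ℝ n T = 0) (h : inner ℝ u T = inner ℝ v T) (hnu : 0 ≤ inner ℝ n u)
    (hnv : 0 ≤ inner ℝ n v) : u = v := by
  have hsq : ∀ x : Plane, ‖x‖ = 1 → x 0 ^ 2 + x 1 ^ 2 = 1 := by
    intro x hx
    have := EuclideanSpace.real_norm_sq_eq x
    rw [hx, Fin.sum_univ_two] at this
    linarith
  have hin : ∀ x y : Plane, inner ℝ x y = x 0 * y 0 + x 1 * y 1 := by
    intro x y
    simp [PiLp.inner_apply, Fin.sum_univ_two, mul_comm]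
  have hu' := hsq u hu
  have hv' := hsq v hv
  have hT' := hsq T hT
  rw [hin] at hnT hnu hnv
  rw [hin, hin] at h
  -- `lam`, `U`, `V` are the coordinates of `n`, `u`, `v` along `T` turned by a right angle; `U` and
  -- `V` agree up to sign, and `n` decides the sign.
  set lam := n 1 * T 0 - n 0 * T 1 with hlam
  have hn0 : n 0 = -(lam * T 1) := by rw [hlam]; linear_combination (-n 0) * hT' + T 0 * hnT
  have hn1 : n 1 = lam * T 0 := by rw [hlam]; linear_combination (-n 1) * hT' + T 1 * hnT
  have hl0 : lam ≠ 0 := by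
    intro h0
    apply hn
    ext i
    fin_cases i
    · simpa [h0] using hn0
    · simpa [h0] using hn1
  set U := u 1 * T 0 - u 0 * T 1 with hU
  set V := v 1 * T 0 - v 0 * T 1 with hV
  have hnu' : 0 ≤ lam * U := by
    have : lam * U = n 0 * u 0 + n 1 * u 1 := by rw [hn0, hn1, hU]; ring
    rwa [this]
  have hnv' : 0 ≤ lam * V := by
    have : lam * V = n 0 * v 0 + n 1 * v 1 := by rw [hn0, hn1, hV]; ring
    rwa [this]
  have hUV : U ^ 2 = V ^ 2 := by
    have e1 : U ^ 2 = 1 - (u 0 * T 0 + u 1 * T 1) ^ 2 := by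
      rw [hU]; linear_combination (T 0 ^ 2 + T 1 ^ 2) * hu' + hT'
    have e2 : V ^ 2 = 1 - (v 0 * T 0 + v 1 * T 1) ^ 2 := by
      rw [hV]; linear_combination (T 0 ^ 2 + T 1 ^ 2) * hv' + hT'
    rw [e1, e2, h]
  have hUV' : U = V := by
    rcases sq_eq_sq_iff_eq_or_eq_neg.1 hUV with h1 | h1
    · exact h1
    · rw [h1] at hnu'
      have : lam * V = 0 := by linarith
      have := (mul_eq_zero.1 this).resolve_left hl0
      rw [h1, this, neg_zero]
  ext i
  fin_cases i
  · show u 0 = v 0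
    rw [hU, hV] at hUV'
    linear_combination (-(u 0) + v 0) * hT' + T 0 * h - T 1 * hUV'
  · show u 1 = v 1
    rw [hU, hV] at hUV'
    linear_combination (-(u 1) + v 1) * hT' + T 1 * h + T 0 * hUV'

end Direction

section Domain

variable {Ω : Set Plane} {γ : ℝ → Plane} {L : ℝ}

/-- A supporting functional at `γ s` attains its maximum over the curve there, so its derivative
along the tangent vanishes. -/
theorem exists_outer_normal (hΩ : IsStrictlyConvexDomain Ω)
    (hγ : IsAnalyticUnitSpeedParam γ L (frontier Ω)) (s : ℝ) :
    ∃ n : Plane, n ≠ 0 ∧ inner ℝ n (deriv γ s) = 0 ∧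
      ∀ x ∈ closure Ω, 0 ≤ inner ℝ n (γ s - x) := by
  obtain ⟨f, hf⟩ := geometric_hahn_banach_open_point hΩ.convex hΩ.isOpen
    (hΩ.notMem_of_mem_frontier (hγ.mem s))
  have hle : ∀ x ∈ closure Ω, f x ≤ f (γ s) := by
    intro x hx
    exact closure_minimal (fun a ha => (hf a ha).le : Ω ⊆ {x | f x ≤ f (γ s)})
      (isClosed_le f.continuous continuous_const) hx
  set n := (InnerProductSpace.toDual ℝ Plane).symm f with hn
  have hnf : ∀ x, inner ℝ n x = f x := fun x => InnerProductSpace.toDual_symm_apply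
  refine ⟨n, ?_, ?_, fun x hx => ?_⟩
  · intro h0
    obtain ⟨c, hc⟩ := hΩ.nonempty
    have := hf c hc
    rw [← hnf, ← hnf, h0, inner_zero_left, inner_zero_left] at this
    exact lt_irrefl _ this
  · have h1 : HasDerivAt (fun s => f (γ s)) (f (deriv γ s)) s :=
      f.hasFDerivAt.comp_hasDerivAt s (hγ.hasDerivAt s)
    rw [hnf]
    refine IsLocalMax.hasDerivAt_eq_zero (f := fun s => f (γ s)) ?_ h1
    exact Eventually.of_forall fun t => hle _ (frontier_subset_closure (hγ.mem t))
  · rw [hnf, map_sub, sub_nonneg]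
    exact hle x hx

/-- Points of the closed domain lie on one side of the tangent line, so the tangential component
fixes the direction in which they are seen. -/
theorem exists_smul_of_tang_eq (hΩ : IsStrictlyConvexDomain Ω)
    (hγ : IsAnalyticUnitSpeedParam γ L (frontier Ω)) {X Y : Plane} {s : ℝ} (hX : X ∈ closure Ω)
    (hY : Y ∈ closure Ω) (hXs : γ s ≠ X) (hYs : γ s ≠ Y) (h : tang γ X s = tang γ Y s) :
    ∃ k : ℝ, 0 < k ∧ γ s - Y = k • (γ s - X) := by
  obtain ⟨n, hn, hnT, hpos⟩ := exists_outer_normal hΩ hγ s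
  have hx0 : 0 < ‖γ s - X‖ := norm_pos_iff.2 (sub_ne_zero.2 hXs)
  have hy0 : 0 < ‖γ s - Y‖ := norm_pos_iff.2 (sub_ne_zero.2 hYs)
  have hu : ∀ v : Plane, 0 < ‖v‖ → ‖(‖v‖⁻¹) • v‖ = 1 := by
    intro v hv
    rw [norm_smul, norm_inv, norm_norm, inv_mul_cancel₀ hv.ne']
  have he := eq_of_inner_eq (hu _ hx0) (hu _ hy0) (hγ.unit_speed s) hn hnT
    (by
      rw [tang, tang, dist_eq_norm, dist_eq_norm] at h
      rw [inner_smul_left, inner_smul_left, conj_trivial, conj_trivial, inv_mul_eq_div, h,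
        inv_mul_eq_div])
    (by rw [inner_smul_right]; exact mul_nonneg (by positivity) (hpos X hX))
    (by rw [inner_smul_right]; exact mul_nonneg (by positivity) (hpos Y hY))
  refine ⟨‖γ s - Y‖ * ‖γ s - X‖⁻¹, by positivity, ?_⟩
  rw [mul_smul, he, smul_smul, mul_inv_cancel₀ hy0.ne', one_smul]

theorem ray_unique_of_mem (hΩ : IsStrictlyConvexDomain Ω) {c w : Plane} {s t : ℝ}
    (hc : c ∈ Ω) (hs : 0 < s) (ht : 0 < t) (h1 : c + s • w ∈ frontier Ω)
    (h2 : c + t • w ∈ frontier Ω) : s = t := by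
  have key : ∀ s t : ℝ, 0 < s → c + s • w ∈ frontier Ω → c + t • w ∈ frontier Ω → ¬ s < t := by
    intro s t hs h1 h2 hst
    have h3 := hΩ.convex.openSegment_closure_interior_subset_interior
      (frontier_subset_closure h2) (by rwa [hΩ.isOpen.interior_eq] : c ∈ interior Ω)
    rw [hΩ.isOpen.interior_eq, openSegment_symm] at h3
    exact hΩ.notMem_of_mem_frontier h1 (h3 (add_smul_mem_openSegment hs hst))
  exact le_antisymm (not_lt.1 (key t s ht h2 h1)) (not_lt.1 (key s t hs h1 h2))

/-! ### The reflection law at the second boundary point -/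

theorem differentiableAt_perimeter (hγ : IsAnalyticUnitSpeedParam γ L (frontier Ω)) {c : Plane}
    {x y : ℝ} (hx : γ x ≠ c) (hy : γ y ≠ c) (hxy : γ x ≠ γ y) :
    DifferentiableAt ℝ (fun z : ℝ × ℝ => perimeter γ c z.1 z.2) (x, y) := by
  have h1 : DifferentiableAt ℝ (fun z : ℝ × ℝ => γ z.1) (x, y) :=
    (hγ.hasDerivAt x).differentiableAt.comp (x, y) differentiableAt_fst
  have h2 : DifferentiableAt ℝ (fun z : ℝ × ℝ => γ z.2) (x, y) :=
    (hγ.hasDerivAt y).differentiableAt.comp (x, y) differentiableAt_snd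
  exact ((h1.dist ℝ (differentiableAt_const c) hx).add (h1.dist ℝ h2 hxy)).add
    (h2.dist ℝ (differentiableAt_const c) hy)

theorem hasDerivAt_perimeter_left (hγ : IsAnalyticUnitSpeedParam γ L (frontier Ω)) {c : Plane}
    {x y : ℝ} (hx : γ x ≠ c) (hxy : γ x ≠ γ y) :
    HasDerivAt (fun s => perimeter γ c s y) (tang γ c x + tang γ (γ y) x) x :=
  ((hγ.hasDerivAt_dist hx).add (hγ.hasDerivAt_dist hxy)).add_const _

theorem perimeter_comm (c : Plane) (x y : ℝ) : perimeter γ c x y = perimeter γ c y x := by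
  rw [perimeter, perimeter, dist_comm (γ x) (γ y)]; ring

theorem hasDerivAt_perimeter_right (hγ : IsAnalyticUnitSpeedParam γ L (frontier Ω)) {c : Plane}
    {x y : ℝ} (hy : γ y ≠ c) (hxy : γ x ≠ γ y) :
    HasDerivAt (fun s => perimeter γ c x s) (tang γ c y + tang γ (γ x) y) y := by
  simp only [perimeter_comm c x]
  exact hasDerivAt_perimeter_left hγ hy hxy.symm

/-- A boundary curve has no constant sum of distances to an interior and a boundary point. -/
theorem not_eventually_dist_add_dist_eq (hΩ : IsStrictlyConvexDomain Ω)
    (hγ : IsAnalyticUnitSpeedParam γ L (frontier Ω)) {c : Plane} (hc : c ∈ Ω) {ξ η K : ℝ}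
    (hne : γ ξ ≠ γ η) : ¬ ∀ᶠ s in 𝓝 ξ, dist (γ s) c + dist (γ s) (γ η) = K := by
  intro h
  have hL := hγ.length_pos
  -- On the open period starting at `η'`, which contains `ξ`, the curve avoids `γ η'` and both
  -- distances are analytic; the identity then reaches `η'` by continuity.
  obtain ⟨η', hη', he⟩ := hγ.exists_eq_mem_Ico (ξ - L) η
  have hlt : ξ - L < η' := by
    refine lt_of_le_of_ne hη'.1 fun h' => hne ?_
    rw [← he, ← h', hγ.periodic.sub_eq]
  have hξ : ξ ∈ Ioo η' (η' + L) := ⟨by linarith [hη'.2], by linarith⟩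
  rw [← he] at h hne
  have han : AnalyticOnNhd ℝ (fun s => dist (γ s) c + dist (γ s) (γ η')) (Ioo η' (η' + L)) := by
    intro s hs
    refine (hγ.analyticAt_dist (ne_of_mem_domain hΩ hγ hc s)).add (hγ.analyticAt_dist fun h' => ?_)
    exact hs.1.ne' (hγ.eq_of_mem_Ico η' ⟨hs.1.le, hs.2⟩ ⟨le_rfl, by linarith⟩ h')
  have hEq := han.eqOn_of_preconnected_of_eventuallyEq (g := fun _ => K)
    (fun _ _ => analyticAt_const) isPreconnected_Ioo hξ h
  have hcl := hEq.closure (by have := hγ.continuous; fun_prop) continuous_const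
  rw [closure_Ioo (by linarith)] at hcl
  have h1 := hcl (⟨le_rfl, by linarith⟩ : η' ∈ Icc η' (η' + L))
  have h2 := hEq hξ
  simp only [dist_self, add_zero] at h1 h2
  have h3 : dist c (γ ξ) + dist (γ ξ) (γ η') = dist c (γ η') := by
    rw [dist_comm c, dist_comm c]; linarith
  have h4 : γ ξ ∈ openSegment ℝ (γ η') c := by
    have hw := (dist_add_dist_eq_iff.1 h3).mem_segment
    rw [openSegment_symm]
    exact mem_openSegment_of_ne_left_right (ne_of_mem_domain hΩ hγ hc ξ).symm hne.symm hw
  have h5 := hΩ.convex.openSegment_closure_interior_subset_interior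
      (frontier_subset_closure (hγ.mem η')) (by rwa [hΩ.isOpen.interior_eq] : c ∈ interior Ω) h4
  rw [hΩ.isOpen.interior_eq] at h5
  exact hΩ.notMem_of_mem_frontier (hγ.mem ξ) h5

theorem IsFocal.tang_add_tang (hΩ : IsStrictlyConvexDomain Ω)
    (hγ : IsAnalyticUnitSpeedParam γ L (frontier Ω)) {c : Plane} (hc : c ∈ Ω) (hf : IsFocal γ c)
    {ξ η : ℝ} (h : ReflectsInto γ c ξ η) : tang γ c η + tang γ (γ ξ) η = 0 := by
  obtain ⟨σ, M, hση, hσc, hσ⟩ := hf.exists_lift hΩ hγ hc h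
  by_contra hne
  have hcn := ne_of_mem_domain hΩ hγ hc
  have hσn : ∀ s, γ s ≠ γ (σ s) := fun s => (hσ s).1.ne hΩ hγ hc
  have hB : ContinuousAt (fun s => tang γ c (σ s) + tang γ (γ s) (σ s)) ξ := by
    have h1 := hσc.self_of_nhds
    have h2 : ContinuousAt (fun s => γ (σ s)) ξ := hγ.continuous.continuousAt.comp h1
    have h3 : ContinuousAt (fun s => deriv γ (σ s)) ξ :=
      (hγ.hasDerivAt_deriv (σ ξ)).continuousAt.comp h1
    have h4 : ContinuousAt γ ξ := hγ.continuous.continuousAt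
    unfold tang
    exact (((h2.sub continuousAt_const).inner (𝕜 := ℝ) h3).div (h2.dist continuousAt_const)
      (dist_ne_zero.2 (hcn _))).add (((h2.sub h4).inner (𝕜 := ℝ) h3).div (h2.dist h4)
      (dist_ne_zero.2 (hσn ξ).symm))
  have hB0 : ∀ᶠ s in 𝓝 ξ, tang γ c (σ s) + tang γ (γ s) (σ s) ≠ 0 := by
    refine hB.eventually_ne ?_
    rwa [hση]
  -- The first partial derivative of the perimeter vanishes by reflection and the second does not,
  -- so constancy of the perimeter forces `σ' = 0`.
  have hder : ∀ᶠ s in 𝓝 ξ, HasDerivAt σ 0 s := by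
    filter_upwards [hσc, hB0] with s hs hs0
    have := hasDerivAt_of_implicit (σ := σ)
      (differentiableAt_perimeter hγ (hcn s) (hcn (σ s)) (hσn s))
      (hasDerivAt_perimeter_left hγ (hcn s) (hσn s))
      (hasDerivAt_perimeter_right hγ (hcn (σ s)) (hσn s)) hs0 hs rfl
      (Eventually.of_forall fun t => by rw [(hσ t).2, (hσ s).2])
    rwa [(hσ s).1.tang_add_tang hγ, neg_zero, zero_div] at this
  obtain ⟨ε, hε, hball⟩ := Metric.eventually_nhds_iff_ball.1 hder
  have hconst : ∀ s ∈ Metric.ball ξ ε, σ s = η := by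
    intro s hs
    rw [← hση]
    refine (convex_ball ξ ε).is_const_of_fderivWithin_eq_zero (𝕜 := ℝ) (f := σ)
      (fun x hx => (hball x hx).differentiableAt.differentiableWithinAt) (fun x hx => ?_) hs
      (Metric.mem_ball_self hε)
    rw [fderivWithin_of_isOpen Metric.isOpen_ball hx]
    ext
    simp [(hball x hx).deriv]
  refine not_eventually_dist_add_dist_eq hΩ hγ hc (K := M - dist (γ η) c) (hση ▸ hσn ξ) ?_
  filter_upwards [Metric.ball_mem_nhds ξ hε] with s hs
  have := (hσ s).2
  rw [perimeter, hconst s hs] at this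
  linarith

/-! ### Double normals -/

/-- The chord from `γ α` to `γ β` is orthogonal to the curve at both endpoints. -/
structure IsDoubleNormal (γ : ℝ → Plane) (α β : ℝ) : Prop where
  ne : γ α ≠ γ β
  left : inner ℝ (γ α - γ β) (deriv γ α) = 0
  right : inner ℝ (γ β - γ α) (deriv γ β) = 0

theorem IsDoubleNormal.symm {α β : ℝ} (h : IsDoubleNormal γ α β) : IsDoubleNormal γ β α :=
  ⟨h.ne.symm, h.right, h.left⟩

theorem IsDoubleNormal.reflectsInto {α β : ℝ} (h : IsDoubleNormal γ α β) {c : Plane}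
    (hc : c ∈ openSegment ℝ (γ α) (γ β)) : ReflectsInto γ c α β := by
  obtain ⟨k, hk, -, h1, -⟩ := exists_smul_of_mem_openSegment hc
  refine ⟨k⁻¹, inv_pos.2 hk, ?_⟩
  rw [Submodule.reflection_singleton_apply, h1, inner_smul_right, real_inner_comm, h.left]
  simp [hk.ne']

/-- The line through two focal points is a double normal. -/
theorem exists_isDoubleNormal (hΩ : IsStrictlyConvexDomain Ω)
    (hγ : IsAnalyticUnitSpeedParam γ L (frontier Ω)) {c c' : Plane} (hc : c ∈ Ω) (hc' : c' ∈ Ω)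
    (hf : IsFocal γ c) (hf' : IsFocal γ c') (hne : c ≠ c') :
    ∃ α β : ℝ, IsDoubleNormal γ α β ∧ c ∈ openSegment ℝ (γ α) (γ β) ∧
      c' ∈ openSegment ℝ (γ α) (γ β) := by
  set w := c' - c with hw
  have hw0 : w ≠ 0 := sub_ne_zero.2 hne.symm
  have hcw : c' = c + (1 : ℝ) • w := by rw [hw]; module
  obtain ⟨t, ht, hA⟩ := hΩ.exists_frontier_ray hc hw0
  have ht1 : 1 < t := by
    by_contra hle
    refine hΩ.notMem_of_mem_frontier hA (hΩ.convex.add_smul_mem hc (y := w) ?_ ⟨ht.le, not_lt.1 hle⟩)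
    rwa [hw, add_sub_cancel]
  obtain ⟨α, hα⟩ : c + t • w ∈ range γ := hγ.range_eq ▸ hA
  obtain ⟨β, hβ⟩ : ∃ β, ReflectsInto γ c α β := by
    obtain ⟨M, hM⟩ := hf
    exact ⟨_, (hM α).choose_spec.1⟩
  -- Only the direction of the incoming segment matters, and `c`, `c'` are seen from `γ α` in the
  -- same direction.
  have hβ' : ReflectsInto γ c' α β := by
    obtain ⟨x, hx, hxe⟩ := hβ
    refine ⟨x * (t / (t - 1)), by have : 0 < t - 1 := by linarith
                                  positivity, ?_⟩
    have e : γ α - c' = ((t - 1) / t) • (γ α - c) := by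
      rw [hα, hcw, add_sub_add_left_eq_sub, add_sub_cancel_left, smul_smul,
        div_mul_cancel₀ _ ht.ne', sub_smul]
    have h0 : t - 1 ≠ 0 := by linarith
    rw [hxe, e, map_smul, smul_smul]
    congr 1
    field_simp
  have hαβ := hβ.ne hΩ hγ hc
  have l1 := hf.tang_add_tang hΩ hγ hc hβ
  have l2 := hf'.tang_add_tang hΩ hγ hc' hβ'
  -- The reflection laws at `γ β` involve the same chord, so `c` and `c'` are also seen from `γ β`
  -- in one direction; hence `γ β` lies on their line.
  obtain ⟨k, hk, hke⟩ := exists_smul_of_tang_eq hΩ hγ (subset_closure hc) (subset_closure hc')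
    (ne_of_mem_domain hΩ hγ hc β) (ne_of_mem_domain hΩ hγ hc' β) (by linarith)
  have hk1 : 1 - k ≠ 0 := by
    intro h
    obtain rfl : k = 1 := by linarith
    rw [one_smul] at hke
    exact hne (sub_right_injective hke).symm
  have hB : γ β = c + (1 - k)⁻¹ • w := by
    have : (1 - k) • (γ β - c) = w := by
      rw [sub_smul, one_smul, ← hke, hw]; abel
    rw [← this, smul_smul, inv_mul_cancel₀ hk1, one_smul]; abel
  set r := (1 - k)⁻¹ with hr
  have hr0 : r < 0 := by
    by_contra hle
    have hrp : 0 < r := lt_of_le_of_ne (not_lt.1 hle) (inv_ne_zero hk1).symm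
    have : r = t := ray_unique_of_mem hΩ hc hrp ht (hB ▸ hγ.mem β) hA
    exact hαβ (by rw [hα, hB, this])
  have hm : c ∈ openSegment ℝ (γ α) (γ β) := by
    rw [hα, hB]
    simpa using mem_openSegment_of_smul (c := c) (w := w) hr0 ht
  have hm' : c' ∈ openSegment ℝ (γ α) (γ β) := by
    rw [hα, hB, hcw]
    exact mem_openSegment_of_smul (by linarith) ht1
  refine ⟨α, β, ⟨hαβ, ?_, ?_⟩, hm, hm'⟩
  all_goals obtain ⟨x, hx, hx1, hxe, hxe'⟩ := exists_smul_of_mem_openSegment hm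
  -- As `c` lies on the chord, the two terms of the reflection law are equal, hence both zero.
  · have h1 := hβ.tang_add_tang hγ
    have h2 := tang_eq_of_smul hx hxe
    have h3 : tang γ (γ β) α = 0 := by linarith
    rw [tang, div_eq_zero_iff] at h3
    exact h3.resolve_right (dist_ne_zero.2 hαβ)
  · have h2 := tang_eq_of_smul (by linarith) hxe'
    have h3 : tang γ (γ α) β = 0 := by linarith
    rw [tang, div_eq_zero_iff] at h3
    exact h3.resolve_right (dist_ne_zero.2 hαβ.symm)

end Domain

end Billiard

namespace Billiard

section Domain

variable {Ω : Set Plane} {γ : ℝ → Plane} {L : ℝ}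

/-! ### Linearization along a double normal -/

/-- At perpendicular incidence the numerator of `tang` vanishes, so the derivative of the distance
in the denominator does not contribute. -/
theorem hasDerivAt_tang_comp {C : Set Plane} (hγ : IsAnalyticUnitSpeedParam γ L C)
    {f : ℝ → Plane} {f' : Plane} {b : ℝ → ℝ} {b' s : ℝ} (hf : HasDerivAt f f' s)
    (hb : HasDerivAt b b' s) (hne : γ (b s) ≠ f s)
    (h0 : inner ℝ (γ (b s) - f s) (deriv γ (b s)) = 0) :
    HasDerivAt (fun t => tang γ (f t) (b t))
      ((b' * (1 + inner ℝ (γ (b s) - f s) (deriv (deriv γ) (b s))) -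
        inner ℝ f' (deriv γ (b s))) / dist (γ (b s)) (f s)) s := by
  have h1 : HasDerivAt (fun t => γ (b t)) (b' • deriv γ (b s)) s :=
    (hγ.hasDerivAt (b s)).scomp s hb
  have h2 : HasDerivAt (fun t => deriv γ (b t)) (b' • deriv (deriv γ) (b s)) s :=
    (hγ.hasDerivAt_deriv (b s)).scomp s hb
  have h3 := (h1.sub hf).inner ℝ h2
  have h4 : DifferentiableAt ℝ (fun t => dist (γ (b t)) (f t)) s :=
    h1.differentiableAt.dist ℝ hf.differentiableAt hne
  have h5 := h3.div h4.hasDerivAt (dist_ne_zero.2 hne)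
  have hd := dist_ne_zero.2 hne
  refine h5.congr_deriv ?_
  simp only [Pi.sub_apply]
  rw [h0, zero_mul, sub_zero, inner_smul_right, inner_sub_left (b' • deriv γ (b s)),
    inner_smul_left, real_inner_self_eq_norm_sq, hγ.unit_speed]
  simp only [conj_trivial]
  field_simp
  ring

theorem hasDerivAt_tang {C : Set Plane} (hγ : IsAnalyticUnitSpeedParam γ L C) {X : Plane} {s : ℝ}
    (hne : γ s ≠ X) (h0 : inner ℝ (γ s - X) (deriv γ s) = 0) :
    HasDerivAt (tang γ X) ((1 + inner ℝ (γ s - X) (deriv (deriv γ) s)) / dist (γ s) X) s := by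
  simpa using hasDerivAt_tang_comp hγ (hasDerivAt_const s X) (hasDerivAt_id s) hne h0

/-- The affine function `1 - 2 ℓ κ` of the curvature `κ` at the endpoint `γ α` of a double normal
of length `ℓ`. -/
noncomputable def normalParam (γ : ℝ → Plane) (α β : ℝ) : ℝ :=
  1 + 2 * inner ℝ (γ α - γ β) (deriv (deriv γ) α)

/-- Both unit tangents are orthogonal to the same chord, hence parallel. -/
theorem IsDoubleNormal.inner_sq {C : Set Plane} (hγ : IsAnalyticUnitSpeedParam γ L C) {α β : ℝ}
    (hd : IsDoubleNormal γ α β) : inner ℝ (deriv γ α) (deriv γ β) ^ 2 = 1 := by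
  have hsq : ∀ s, deriv γ s 0 ^ 2 + deriv γ s 1 ^ 2 = 1 := by
    intro s
    have := EuclideanSpace.real_norm_sq_eq (deriv γ s)
    rw [hγ.unit_speed, Fin.sum_univ_two] at this
    linarith
  have hin : ∀ x y : Plane, inner ℝ x y = x 0 * y 0 + x 1 * y 1 := by
    intro x y
    simp [PiLp.inner_apply, Fin.sum_univ_two, mul_comm]
  have h1 := hd.left
  have h2 := hd.right
  rw [← neg_sub, inner_neg_left, neg_eq_zero] at h2
  rw [hin] at h1 h2 ⊢
  have hw : (γ α - γ β) 0 ≠ 0 ∨ (γ α - γ β) 1 ≠ 0 := by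
    by_contra hcon
    push Not at hcon
    apply sub_ne_zero.2 hd.ne
    ext i
    fin_cases i
    · exact hcon.1
    · exact hcon.2
  set w := γ α - γ β
  have ha := hsq α
  have hb := hsq β
  set a := deriv γ α
  set b := deriv γ β
  have hcr : a 0 * b 1 - a 1 * b 0 = 0 := by
    rcases hw with hw | hw
    · have : w 0 * (a 0 * b 1 - a 1 * b 0) = 0 := by linear_combination b 1 * h1 - a 1 * h2
      exact (mul_eq_zero.1 this).resolve_left hw
    · have : w 1 * (a 0 * b 1 - a 1 * b 0) = 0 := by linear_combination -b 0 * h1 + a 0 * h2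
      exact (mul_eq_zero.1 this).resolve_left hw
  linear_combination (b 0 ^ 2 + b 1 ^ 2) * ha + hb - (a 0 * b 1 - a 1 * b 0) * hcr

theorem differentiableAt_tang_pair {C : Set Plane} (hγ : IsAnalyticUnitSpeedParam γ L C)
    {c : Plane} {x y : ℝ} (hx : γ x ≠ c) (hxy : γ x ≠ γ y) :
    DifferentiableAt ℝ (fun z : ℝ × ℝ => tang γ c z.1 + tang γ (γ z.2) z.1) (x, y) := by
  have h1 : DifferentiableAt ℝ (fun z : ℝ × ℝ => γ z.1) (x, y) :=
    (hγ.hasDerivAt x).differentiableAt.comp (x, y) differentiableAt_fst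
  have h2 : DifferentiableAt ℝ (fun z : ℝ × ℝ => γ z.2) (x, y) :=
    (hγ.hasDerivAt y).differentiableAt.comp (x, y) differentiableAt_snd
  have h3 : DifferentiableAt ℝ (fun z : ℝ × ℝ => deriv γ z.1) (x, y) :=
    DifferentiableAt.comp (x, y) (g := deriv γ) (hγ.hasDerivAt_deriv x).differentiableAt
      differentiableAt_fst
  have h4 : DifferentiableAt ℝ (fun z : ℝ × ℝ => tang γ c z.1) (x, y) := by
    simp only [tang, div_eq_mul_inv]
    exact ((h1.sub_const c).inner ℝ h3).fun_mul
      ((h1.dist ℝ (differentiableAt_const c) hx).fun_inv (dist_ne_zero.2 hx))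
  have h5 : DifferentiableAt ℝ (fun z : ℝ × ℝ => tang γ (γ z.2) z.1) (x, y) := by
    simp only [tang, div_eq_mul_inv]
    exact ((h1.fun_sub h2).inner ℝ h3).fun_mul ((h1.dist ℝ h2 hxy).fun_inv (dist_ne_zero.2 hxy))
  exact h4.fun_add h5

/-- The first order behaviour of the reflection map of a focal point at a double normal. -/
theorem IsFocal.linearization (hΩ : IsStrictlyConvexDomain Ω)
    (hγ : IsAnalyticUnitSpeedParam γ L (frontier Ω)) {c : Plane} (hc : c ∈ Ω) (hf : IsFocal γ c)
    {α β k : ℝ} (hd : IsDoubleNormal γ α β) (hk0 : 0 < k) (hk1 : k < 1)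
    (hk : γ α - c = k • (γ α - γ β)) :
    (k⁻¹ + normalParam γ α β) * ((1 - k)⁻¹ + normalParam γ β α) = 1 ∧
      ∃ (σ : ℝ → ℝ) (x : ℝ), σ α = β ∧ HasDerivAt σ x α ∧ |x| = |k⁻¹ + normalParam γ α β| ∧
        ∀ s, ReflectsInto γ c s (σ s) := by
  have hcn := ne_of_mem_domain hΩ hγ hc
  have hk' : γ β - c = (1 - k) • (γ β - γ α) := by
    have : γ β - c = (γ α - c) - (γ α - γ β) := by abel
    rw [this, hk]; module
  have hkk : 0 < 1 - k := by linarith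
  have hmem : c ∈ openSegment ℝ (γ α) (γ β) := by
    refine ⟨1 - k, k, hkk, hk0, by ring, ?_⟩
    have : c = γ α - (γ α - c) := by abel
    rw [this, hk]; module
  obtain ⟨σ, M, hσα, hσc, hσ⟩ := hf.exists_lift hΩ hγ hc (hd.reflectsInto hmem)
  have hℓ : 0 < dist (γ α) (γ β) := dist_pos.2 hd.ne
  have hda : dist (γ α) c = k * dist (γ α) (γ β) := by
    rw [dist_eq_norm, hk, norm_smul, Real.norm_of_nonneg hk0.le, dist_eq_norm]
  have hdb : dist (γ β) c = (1 - k) * dist (γ α) (γ β) := by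
    rw [dist_eq_norm, hk', norm_smul, Real.norm_of_nonneg hkk.le, dist_comm, dist_eq_norm]
  have ha0 : inner ℝ (γ α - c) (deriv γ α) = 0 := by rw [hk, inner_smul_left, hd.left, mul_zero]
  have hb0 : inner ℝ (γ β - c) (deriv γ β) = 0 := by rw [hk', inner_smul_left, hd.right, mul_zero]
  -- `ε = ±1` compares the orientations of the two tangents; it drops out of the product and of the
  -- absolute value.
  set ε := inner ℝ (deriv γ β) (deriv γ α) with hε
  have hεsq : ε ^ 2 = 1 := hd.symm.inner_sq hγ
  have hε0 : ε ≠ 0 := by intro h; rw [h] at hεsq; norm_num at hεsq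
  have e1 := (hasDerivAt_tang hγ (hcn α) ha0).add (hasDerivAt_tang hγ hd.ne hd.left)
  have e2 := (hasDerivAt_const β (tang γ c α)).add
    (hasDerivAt_tang_comp hγ (hγ.hasDerivAt β) (hasDerivAt_const β α) hd.ne hd.left)
  have hσ' := hasDerivAt_of_implicit (σ := σ) (differentiableAt_tang_pair hγ (hcn α) hd.ne) e1 e2
    (by
      rw [zero_mul, zero_sub, zero_add]
      exact div_ne_zero (neg_ne_zero.2 hε0) hℓ.ne')
    hσc.self_of_nhds hσα (Eventually.of_forall fun s => by
      show tang γ c s + tang γ (γ (σ s)) s = tang γ c α + tang γ (γ β) α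
      rw [(hσ s).1.tang_add_tang hγ, (hd.reflectsInto hmem).tang_add_tang hγ])
  set x := (-((1 + inner ℝ (γ α - c) (deriv (deriv γ) α)) / dist (γ α) c +
      (1 + inner ℝ (γ α - γ β) (deriv (deriv γ) α)) / dist (γ α) (γ β)) /
        (0 + (0 * (1 + inner ℝ (γ α - γ β) (deriv (deriv γ) α)) -
          inner ℝ (deriv γ β) (deriv γ α)) / dist (γ α) (γ β))) with hx
  have hxp : x * ε = k⁻¹ + normalParam γ α β := by
    rw [hx, normalParam, ← hε, hda, hk, inner_smul_left]
    simp only [conj_trivial, zero_mul, zero_sub, zero_add]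
    field_simp
    ring
  have hxa : |x| = |k⁻¹ + normalParam γ α β| := by
    rw [← hxp, abs_mul, (sq_eq_sq₀ (abs_nonneg ε) one_pos.le).1 (by rw [sq_abs, hεsq, one_pow]),
      mul_one]
  refine ⟨?_, σ, x, hσα, hσ', hxa, fun s => (hσ s).1⟩
  -- The derivative `x` came from the law at `γ α`; differentiating the law at `γ (σ s)` gives a
  -- second equation for it.
  have g1 := hasDerivAt_tang_comp hγ (hasDerivAt_const α c) hσ' (hcn _) (by rw [hσα]; exact hb0)
  have g2 := hasDerivAt_tang_comp hγ (hγ.hasDerivAt α) hσ' (by rw [hσα]; exact hd.ne.symm)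
    (by rw [hσα]; exact hd.right)
  have g3 := (g1.add g2).unique ((hasDerivAt_const α (0 : ℝ)).congr_of_eventuallyEq
    (Eventually.of_forall fun s => hf.tang_add_tang hΩ hγ hc (hσ s).1))
  rw [hσα, inner_zero_left, hdb, dist_comm (γ α), real_inner_comm (deriv γ β), ← hε, hk',
    inner_smul_left] at g3
  rw [dist_comm] at hℓ
  have g4 : x * ((1 - k)⁻¹ + normalParam γ β α) = ε := by
    rw [normalParam]
    simp only [conj_trivial] at g3
    field_simp at g3 ⊢
    linear_combination g3
  have h5 : ε * (x * ε * ((1 - k)⁻¹ + normalParam γ β α) - 1) = 0 := by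
    linear_combination ε ^ 2 * g4 + ε * hεsq
  rw [← hxp]
  linear_combination (mul_eq_zero.1 h5).resolve_left hε0

end Domain

end Billiard

/-! ### Conjugate points on a double normal -/

namespace Billiard

/-- Two distinct points dividing a chord in ratios that satisfy the same mirror equation are
conjugate, unless the chord is confocal. -/
theorem inv_add_inv_eq_of_mirror {k k' u v : ℝ} (hk0 : 0 < k) (hk1 : k < 1) (hk0' : 0 < k')
    (hk1' : k' < 1) (hne : k ≠ k') (h : (k⁻¹ + u) * ((1 - k)⁻¹ + v) = 1)
    (h' : (k'⁻¹ + u) * ((1 - k')⁻¹ + v) = 1) :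
    (u = -1 ∧ v = -1) ∨ k⁻¹ + k'⁻¹ = 1 - u := by
  have e1 : 1 - k ≠ 0 := by linarith
  have e1' : 1 - k' ≠ 0 := by linarith
  have h1 : (1 + u * k) * (1 + v * (1 - k)) = k * (1 - k) := by
    field_simp at h; linear_combination h
  have h1' : (1 + u * k') * (1 + v * (1 - k')) = k' * (1 - k') := by
    field_simp at h'; linear_combination h'
  have hsub : k - k' ≠ 0 := sub_ne_zero.2 hne
  -- `h2` and `h3` are Vieta's relations for the quadratic with roots `k` and `k'`; it degenerates
  -- exactly when `u * v = 1`.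
  have h2 : (1 - u * v) * (k + k') + (u - v + u * v - 1) = 0 := by
    refine (mul_eq_zero.1 ?_).resolve_left hsub
    linear_combination h1 - h1'
  have h3 : (1 - u * v) * (k * k') = 1 + v := by
    linear_combination k * h2 - h1
  have h4 : (1 - u * v) * (k + k' - (1 - u) * (k * k')) = 0 := by
    linear_combination h2 - (1 - u) * h3
  rcases mul_eq_zero.1 h4 with h5 | h5
  · left
    have hv : v = -1 := by rw [h5] at h3; linarith
    refine ⟨?_, hv⟩
    rw [hv] at h5; linarith
  · right
    field_simp
    linarith

/-! ### Strict local extrema of the distance -/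

/-- Upgrades the weak extrema supplied by the second derivative test to strict ones. -/
theorem eventually_ne_of_analyticAt {f : ℝ → ℝ} {x : ℝ} (hf : AnalyticAt ℝ f x)
    (hne : ¬ ∀ᶠ y in 𝓝 x, f y = f x) : ∀ᶠ y in 𝓝[≠] x, f y ≠ f x :=
  (hf.eventually_eq_or_eventually_ne analyticAt_const).resolve_left hne

section Domain

variable {Ω : Set Plane} {γ : ℝ → Plane} {L : ℝ}

theorem deriv_dist (hΩ : IsStrictlyConvexDomain Ω)
    (hγ : IsAnalyticUnitSpeedParam γ L (frontier Ω)) {c : Plane} (hc : c ∈ Ω) :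
    deriv (fun s => dist (γ s) c) = tang γ c :=
  funext fun s => (hγ.hasDerivAt_dist (ne_of_mem_domain hΩ hγ hc s)).deriv

theorem not_eventually_dist_const (hΩ : IsStrictlyConvexDomain Ω)
    (hγ : IsAnalyticUnitSpeedParam γ L (frontier Ω)) {c : Plane} (hc : c ∈ Ω) {α m : ℝ}
    (hm : HasDerivAt (tang γ c) m α) (hm0 : m ≠ 0) :
    ¬ ∀ᶠ s in 𝓝 α, dist (γ s) c = dist (γ α) c := by
  intro h
  have h1 : (fun s => dist (γ s) c) =ᶠ[𝓝 α] fun _ => dist (γ α) c := h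
  have h2 := h1.deriv.deriv_eq
  rw [deriv_dist hΩ hγ hc, hm.deriv] at h2
  simp at h2
  exact hm0 h2

theorem eventually_dist_lt (hΩ : IsStrictlyConvexDomain Ω)
    (hγ : IsAnalyticUnitSpeedParam γ L (frontier Ω)) {c : Plane} (hc : c ∈ Ω) {α m : ℝ}
    (h0 : tang γ c α = 0) (hm : HasDerivAt (tang γ c) m α) (hm0 : 0 < m) :
    ∀ᶠ s in 𝓝[≠] α, dist (γ α) c < dist (γ s) c := by
  have hcn := ne_of_mem_domain hΩ hγ hc
  have hmin : IsLocalMin (fun s => dist (γ s) c) α := by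
    refine isLocalMin_of_deriv_deriv_pos ?_ ?_ (hγ.analyticAt_dist (hcn α)).continuousAt
    · rwa [deriv_dist hΩ hγ hc, hm.deriv]
    · rwa [deriv_dist hΩ hγ hc]
  filter_upwards [hmin.filter_mono nhdsWithin_le_nhds, eventually_ne_of_analyticAt
    (hγ.analyticAt_dist (hcn α)) (not_eventually_dist_const hΩ hγ hc hm hm0.ne')] with s h1 h2
  exact lt_of_le_of_ne h1 (Ne.symm h2)

theorem isStrictLocalExtr_dist (hΩ : IsStrictlyConvexDomain Ω)
    (hγ : IsAnalyticUnitSpeedParam γ L (frontier Ω)) {c : Plane} (hc : c ∈ Ω) {α m : ℝ}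
    (h0 : tang γ c α = 0) (hm : HasDerivAt (tang γ c) m α) (hm0 : m ≠ 0) :
    IsStrictLocalExtr (fun s => dist (γ s) c) α := by
  have hcn := ne_of_mem_domain hΩ hγ hc
  rcases hm0.lt_or_gt with hlt | hgt
  · right
    have hmax : IsLocalMax (fun s => dist (γ s) c) α := by
      refine isLocalMax_of_deriv_deriv_neg ?_ ?_ (hγ.analyticAt_dist (hcn α)).continuousAt
      · rwa [deriv_dist hΩ hγ hc, hm.deriv]
      · rwa [deriv_dist hΩ hγ hc]
    filter_upwards [hmax.filter_mono nhdsWithin_le_nhds, eventually_ne_of_analyticAt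
      (hγ.analyticAt_dist (hcn α)) (not_eventually_dist_const hΩ hγ hc hm hm0)] with s h1 h2
    exact lt_of_le_of_ne h1 h2
  · exact Or.inl (eventually_dist_lt hΩ hγ hc h0 hm hgt)

theorem eq_of_mem_openSegment (hΩ : IsStrictlyConvexDomain Ω)
    (hγ : IsAnalyticUnitSpeedParam γ L (frontier Ω)) {c : Plane} (hc : c ∈ Ω) {α β δ : ℝ}
    (hβ : c ∈ openSegment ℝ (γ α) (γ β)) (hδ : c ∈ openSegment ℝ (γ α) (γ δ)) : γ β = γ δ := by
  obtain ⟨k, hk, -, hk1, -⟩ := exists_smul_of_mem_openSegment hβ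
  obtain ⟨l, hl, -, hl1, -⟩ := exists_smul_of_mem_openSegment hδ
  have e1 : γ β = γ α + k⁻¹ • (c - γ α) := by
    rw [← neg_sub (γ α) c, hk1, smul_neg, smul_smul, inv_mul_cancel₀ hk.ne', one_smul]; abel
  have e2 : γ δ = γ α + l⁻¹ • (c - γ α) := by
    rw [← neg_sub (γ α) c, hl1, smul_neg, smul_smul, inv_mul_cancel₀ hl.ne', one_smul]; abel
  rw [e1, e2, hΩ.ray_unique (hγ.mem α) (inv_pos.2 hk) (inv_pos.2 hl)
    (sub_ne_zero.2 (ne_of_mem_domain hΩ hγ hc α).symm) (e1 ▸ hγ.mem β) (e2 ▸ hγ.mem δ)]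

/-- If the distance to `c` has strict local minima at both ends of a chord through `c`, then `c` is
of the first kind, because there must be a maximum elsewhere. -/
theorem isFirstKind_of_strict_min (hΩ : IsStrictlyConvexDomain Ω)
    (hγ : IsAnalyticUnitSpeedParam γ L (frontier Ω)) {c : Plane} (hc : c ∈ Ω) {α β : ℝ}
    (hmem : c ∈ openSegment ℝ (γ α) (γ β))
    (hα : ∀ᶠ s in 𝓝[≠] α, dist (γ α) c < dist (γ s) c)
    (hβ : ∀ᶠ s in 𝓝[≠] β, dist (γ β) c < dist (γ s) c) : IsFirstKind γ c := by
  have hcn := ne_of_mem_domain hΩ hγ hc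
  obtain ⟨δ, -, hδ⟩ := isCompact_Icc.exists_isMaxOn (nonempty_Icc.2 hγ.length_pos.le)
    ((hγ.continuous.dist continuous_const).continuousOn (f := fun s => dist (γ s) c))
  have hmax : ∀ s, dist (γ s) c ≤ dist (γ δ) c := by
    intro s
    obtain ⟨t, ht, hts⟩ := hγ.exists_eq_mem_Ico 0 s
    rw [zero_add] at ht
    rw [← hts]
    exact hδ (Ico_subset_Icc_self ht)
  have hne : ∀ x, (∀ᶠ s in 𝓝[≠] x, dist (γ x) c < dist (γ s) c) → γ x ≠ γ δ := by
    intro x hx h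
    obtain ⟨s, hs⟩ := hx.exists
    rw [h] at hs
    exact absurd (hmax s) (not_le.2 hs)
  have hnc : ¬ ∀ᶠ s in 𝓝 δ, dist (γ s) c = dist (γ δ) c := by
    intro h
    have h1 := AnalyticOnNhd.eq_of_eventuallyEq (𝕜 := ℝ) (f := fun s => dist (γ s) c)
      (g := fun _ => dist (γ δ) c) (fun s _ => hγ.analyticAt_dist (hcn s))
      (fun _ _ => analyticAt_const) h
    obtain ⟨s, hs⟩ := hα.exists
    rw [congrFun h1 s, congrFun h1 α] at hs
    exact lt_irrefl _ hs
  -- The point antipodal to `γ α` is unique, namely `γ β`, which is a strict minimum and so not the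
  -- global maximum `γ δ`.
  refine ⟨α, δ, hne α hα, Or.inl hα, Or.inr ?_, fun hanti => hne β hβ ?_⟩
  · filter_upwards [eventually_ne_of_analyticAt (hγ.analyticAt_dist (hcn δ)) hnc] with s hs
    exact lt_of_le_of_ne (hmax s) hs
  · exact eq_of_mem_openSegment hΩ hγ hc hmem hanti

theorem IsDoubleNormal.exists_hasDerivAt_tang (hΩ : IsStrictlyConvexDomain Ω)
    (hγ : IsAnalyticUnitSpeedParam γ L (frontier Ω)) {c : Plane} (hc : c ∈ Ω) {α β k : ℝ}
    (hd : IsDoubleNormal γ α β) (hk0 : 0 < k) (hk : γ α - c = k • (γ α - γ β)) :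
    tang γ c α = 0 ∧ HasDerivAt (tang γ c)
      ((2 + k * (normalParam γ α β - 1)) / (2 * (k * dist (γ α) (γ β)))) α := by
  have h0 : inner ℝ (γ α - c) (deriv γ α) = 0 := by rw [hk, inner_smul_left, hd.left, mul_zero]
  refine ⟨by rw [tang, h0, zero_div], ?_⟩
  refine (hasDerivAt_tang hγ (ne_of_mem_domain hΩ hγ hc α) h0).congr_deriv ?_
  rw [dist_eq_norm, hk, norm_smul, Real.norm_of_nonneg hk0.le, ← dist_eq_norm, inner_smul_left,
    normalParam]
  simp only [conj_trivial]
  have : dist (γ α) (γ β) ≠ 0 := dist_ne_zero.2 hd.ne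
  field_simp
  ring

/-- A second focal point on a double normal through a focal point of the second kind is its
conjugate, and the distance to the first one has strict local extrema at both ends. -/
theorem IsSecondKind.conjugate (hΩ : IsStrictlyConvexDomain Ω)
    (hγ : IsAnalyticUnitSpeedParam γ L (frontier Ω)) {c c' : Plane} (hc : c ∈ Ω) (hc' : c' ∈ Ω)
    (hf : IsFocal γ c) (hf' : IsFocal γ c') (hs : IsSecondKind γ c) {α β k k' : ℝ}
    (hd : IsDoubleNormal γ α β) (hk0 : 0 < k) (hk1 : k < 1)
    (hk : γ α - c = k • (γ α - γ β)) (hk0' : 0 < k') (hk1' : k' < 1)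
    (hk' : γ α - c' = k' • (γ α - γ β)) (hne : k ≠ k') :
    k⁻¹ + k'⁻¹ = 1 - normalParam γ α β ∧ IsStrictLocalExtr (fun s => dist (γ s) c) α := by
  obtain ⟨e, -⟩ := hf.linearization hΩ hγ hc hd hk0 hk1 hk
  obtain ⟨e', -⟩ := hf'.linearization hΩ hγ hc' hd hk0' hk1' hk'
  have hℓ : 0 < dist (γ α) (γ β) := dist_pos.2 hd.ne
  obtain ⟨ha, ha'⟩ := hd.exists_hasDerivAt_tang hΩ hγ hc hk0 hk
  rcases inv_add_inv_eq_of_mirror hk0 hk1 hk0' hk1' hne e e' with ⟨hu, hv⟩ | h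
  -- Confocal case: the second derivatives at the two ends have the signs of `1 - k` and `k`, so
  -- both ends are strict minima.
  · exfalso
    have hkb : γ β - c = (1 - k) • (γ β - γ α) := by
      have : γ β - c = (γ α - c) - (γ α - γ β) := by abel
      rw [this, hk]; module
    have hkk : 0 < 1 - k := by linarith
    obtain ⟨hb, hb'⟩ := hd.symm.exists_hasDerivAt_tang hΩ hγ hc hkk hkb
    have hmem : c ∈ openSegment ℝ (γ α) (γ β) := by
      refine ⟨1 - k, k, hkk, hk0, by ring, ?_⟩
      have : c = γ α - (γ α - c) := by abel
      rw [this, hk]; module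
    rw [hu] at ha'
    rw [hv, dist_comm] at hb'
    exact hs (isFirstKind_of_strict_min hΩ hγ hc hmem
      (eventually_dist_lt hΩ hγ hc ha ha' (div_pos (by linarith) (by positivity)))
      (eventually_dist_lt hΩ hγ hc hb hb' (div_pos (by linarith) (by positivity))))
  · refine ⟨h, isStrictLocalExtr_dist hΩ hγ hc ha ha' (div_ne_zero ?_ (by positivity))⟩
    -- A vanishing second derivative would make `c` its own conjugate, that is `k' = k`.
    intro h0
    apply hne
    have h1 : 1 - normalParam γ α β = 2 * k⁻¹ := by
      field_simp
      linear_combination -h0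
    have h2 : k'⁻¹ = k⁻¹ := by linarith
    exact (inv_injective h2).symm

/-! ### At most two focal points -/

theorem exists_smul_pair {p q x y : Plane} (hx : x ∈ openSegment ℝ p q)
    (hy : y ∈ openSegment ℝ p q) (hne : x ≠ y) :
    ∃ k l : ℝ, k ≠ l ∧ 0 < k ∧ k < 1 ∧ p - x = k • (p - q) ∧ 0 < l ∧ l < 1 ∧
      p - y = l • (p - q) := by
  obtain ⟨k, hk0, hk1, hk, -⟩ := exists_smul_of_mem_openSegment hx
  obtain ⟨l, hl0, hl1, hl, -⟩ := exists_smul_of_mem_openSegment hy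
  refine ⟨k, l, ?_, hk0, hk1, hk, hl0, hl1, hl⟩
  rintro rfl
  exact hne (sub_right_injective (hk.trans hl.symm))

/-- The ends of the double normals towards `x` and `y` are strict extrema of the distance to `c`.
Since `c` is of the second kind they coincide or are antipodal, so both normals are one chord, on
which `c` has a single conjugate. -/
theorem not_three_focal (hΩ : IsStrictlyConvexDomain Ω)
    (hγ : IsAnalyticUnitSpeedParam γ L (frontier Ω)) {c x y : Plane} (hc : c ∈ Ω) (hx : x ∈ Ω)
    (hy : y ∈ Ω) (hfc : IsFocal γ c) (hfx : IsFocal γ x) (hfy : IsFocal γ y)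
    (hs : IsSecondKind γ c) (hcx : c ≠ x) (hcy : c ≠ y) : x = y := by
  obtain ⟨α, β, hd, hcm, hxm⟩ := exists_isDoubleNormal hΩ hγ hc hx hfc hfx hcx
  obtain ⟨α', β', hd', hcm', hym⟩ := exists_isDoubleNormal hΩ hγ hc hy hfc hfy hcy
  obtain ⟨k, l, hkl, hk0, hk1, hk, hl0, hl1, hl⟩ := exists_smul_pair hcm hxm hcx
  obtain ⟨k', l', hkl', hk0', hk1', hk', hl0', hl1', hl'⟩ := exists_smul_pair hcm' hym hcy
  have h1 := IsSecondKind.conjugate hΩ hγ hc hx hfc hfx hs hd hk0 hk1 hk hl0 hl1 hl hkl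
  have h2 := IsSecondKind.conjugate hΩ hγ hc hy hfc hfy hs hd' hk0' hk1' hk' hl0' hl1' hl' hkl'
  have hym' : y ∈ openSegment ℝ (γ α) (γ β) := by
    by_cases h : γ α = γ α'
    · rw [h] at hcm ⊢
      rwa [eq_of_mem_openSegment hΩ hγ hc hcm hcm']
    · have hanti : Antipodal c (γ α) (γ α') := by
        by_contra hna
        exact hs ⟨α, α', h, h1.2, h2.2, hna⟩
      have e1 := eq_of_mem_openSegment hΩ hγ hc hcm hanti
      rw [Antipodal, openSegment_symm] at hanti
      have e2 := eq_of_mem_openSegment hΩ hγ hc hanti hcm'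
      rw [e1, e2, openSegment_symm]
      exact hym
  obtain ⟨m, n, hmn, hm0, hm1, hm, hn0, hn1, hn⟩ := exists_smul_pair hcm hym' hcy
  have h3 := IsSecondKind.conjugate hΩ hγ hc hy hfc hfy hs hd hm0 hm1 hm hn0 hn1 hn hmn
  have hw : γ α - γ β ≠ 0 := sub_ne_zero.2 hd.ne
  obtain rfl : k = m := smul_left_injective ℝ hw (hk.symm.trans hm)
  have hln : l = n := inv_injective (by linarith [h1.1, h3.1])
  rw [hln] at hl
  exact sub_right_injective (hl.trans hn.symm)

end Domain

end Billiard

/-! ### Scaling near a fixed point -/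

namespace Billiard

/-- An analytic function that scales along a map with a fixed point by a factor inverse to the
multiplier of the map vanishes, unless the multiplier has absolute value one. -/
theorem eventually_eq_zero_of_scaling {D ρ X Y : ℝ → ℝ} {α ν : ℝ} (hD : AnalyticAt ℝ D α)
    (hρ : HasDerivAt ρ ν α) (hρα : ρ α = α) (hX : ContinuousAt X α) (hY : ContinuousAt Y α)
    (h : ∀ s, D (ρ s) * X s = D s * Y s) (hν : |ν| * |Y α| = |X α|) (hX0 : X α ≠ 0)
    (hν1 : |ν| ≠ 1) : ∀ᶠ s in 𝓝 α, D s = 0 := by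
  by_contra hne
  -- Leading coefficients at order `n` give `ν ^ n * X α = Y α`; with `hν` this is `|ν| ^ (n + 1) =
  -- 1`, impossible even for `n = 0`.
  obtain ⟨n, g, hg, hg0, hDg⟩ := hD.exists_eventuallyEq_pow_smul_nonzero_iff.2 hne
  have hρc : Tendsto ρ (𝓝 α) (𝓝 α) := by
    have := hρ.continuousAt
    rwa [ContinuousAt, hρα] at this
  have hslope : Tendsto (fun s => (ρ s - α) / (s - α)) (𝓝[≠] α) (𝓝 ν) := by
    have := hasDerivAt_iff_tendsto_slope.1 hρ
    refine this.congr fun s => ?_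
    rw [slope_def_field, hρα]
  have hle : 𝓝[≠] α ≤ 𝓝 α := nhdsWithin_le_nhds
  have t1 : Tendsto (fun s => ((ρ s - α) / (s - α)) ^ n * g (ρ s) * X s) (𝓝[≠] α)
      (𝓝 (ν ^ n * g α * X α)) :=
    ((hslope.pow n).mul ((hg.continuousAt.tendsto.comp hρc).mono_left hle)).mul (hX.mono_left hle)
  have t2 : Tendsto (fun s => g s * Y s) (𝓝[≠] α) (𝓝 (g α * Y α)) :=
    (hg.continuousAt.tendsto.mono_left hle).mul (hY.mono_left hle)
  have heq : ν ^ n * g α * X α = g α * Y α := by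
    refine tendsto_nhds_unique (t1.congr' ?_) t2
    filter_upwards [hle hDg, hle (hρc.eventually hDg), self_mem_nhdsWithin] with s h1 h2 h3
    have h4 : s - α ≠ 0 := sub_ne_zero.2 h3
    have h5 := h s
    rw [h1, h2, smul_eq_mul, smul_eq_mul] at h5
    rw [div_pow]
    field_simp
    linarith
  have h1 : ν ^ n * X α = Y α := by
    refine mul_left_cancel₀ hg0 ?_
    linarith
  have h2 : |ν| ^ (n + 1) * |X α| = 1 * |X α| := by
    rw [one_mul]
    conv_rhs => rw [← hν, ← h1, abs_mul, abs_pow]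
    ring
  have h3 := mul_right_cancel₀ (abs_ne_zero.2 hX0) h2
  exact hν1 ((pow_eq_one_iff_of_nonneg (abs_nonneg ν) (Nat.succ_ne_zero n)).1 h3)

/-! ### Deviation of a chord from a point -/

/-- The cross product of two vectors of the plane. -/
def cross (x y : Plane) : ℝ := x 0 * y 1 - x 1 * y 0

theorem plane_inner (x y : Plane) : inner ℝ x y = x 0 * y 0 + x 1 * y 1 := by
  simp [PiLp.inner_apply, Fin.sum_univ_two, mul_comm]

theorem plane_norm_sq (x : Plane) : x 0 ^ 2 + x 1 ^ 2 = ‖x‖ ^ 2 := by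
  rw [EuclideanSpace.real_norm_sq_eq, Fin.sum_univ_two]

theorem cross_smul (a b : ℝ) (x y : Plane) : cross (a • x) (b • y) = a * b * cross x y := by
  simp only [cross, PiLp.smul_apply, smul_eq_mul]
  ring

theorem cross_sq_add_inner_sq (x y : Plane) :
    cross x y ^ 2 + inner ℝ x y ^ 2 = ‖x‖ ^ 2 * ‖y‖ ^ 2 := by
  rw [← plane_norm_sq, ← plane_norm_sq, plane_inner, cross]
  ring

theorem continuousAt_cross {f g : ℝ → Plane} {x : ℝ} (hf : ContinuousAt f x)
    (hg : ContinuousAt g x) : ContinuousAt (fun s => cross (f s) (g s)) x := by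
  unfold cross
  fun_prop

/-- For unit vectors, `v - u` is `u + v` turned by a right angle and scaled by the tangent of half
the angle between them, `cross u v / (1 + inner ℝ u v)`; clearing the denominator admits `v = -u`.
-/
theorem one_add_inner_mul_inner_sub {u v : Plane} (hu : ‖u‖ = 1) (hv : ‖v‖ = 1) (T : Plane) :
    (1 + inner ℝ u v) * inner ℝ (v - u) T = cross u v * cross (u + v) T := by
  have h1 := plane_norm_sq u
  have h2 := plane_norm_sq v
  rw [hu] at h1
  rw [hv] at h2
  simp only [plane_inner, cross, PiLp.sub_apply, PiLp.add_apply]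
  linear_combination (-v 0 * T 0 - v 1 * T 1) * h1 + (u 0 * T 0 + u 1 * T 1) * h2

/-- The unit vector pointing from `Y` to `X`. -/
noncomputable def unitVec (X Y : Plane) : Plane := (dist X Y)⁻¹ • (X - Y)

theorem norm_unitVec {X Y : Plane} (h : X ≠ Y) : ‖unitVec X Y‖ = 1 := by
  rw [unitVec, norm_smul, norm_inv, Real.norm_of_nonneg dist_nonneg, dist_eq_norm,
    inv_mul_cancel₀ (norm_ne_zero_iff.2 (sub_ne_zero.2 h))]

theorem unitVec_comm (X Y : Plane) : unitVec Y X = -unitVec X Y := by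
  rw [unitVec, unitVec, dist_comm, ← smul_neg, neg_sub]

theorem continuousAt_unitVec {f g : ℝ → Plane} {x : ℝ} (hf : ContinuousAt f x)
    (hg : ContinuousAt g x) (h : f x ≠ g x) : ContinuousAt (fun s => unitVec (f s) (g s)) x :=
  ((hf.dist hg).inv₀ (dist_ne_zero.2 h)).smul (hf.sub hg)

theorem unitVec_eq_of_smul {p q x : Plane} {k : ℝ} (hk : 0 < k) (h : p - x = k • (p - q)) :
    unitVec p x = unitVec p q := by
  rw [unitVec, unitVec, dist_eq_norm, h, dist_eq_norm, norm_smul, Real.norm_of_nonneg hk.le,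
    smul_smul, mul_inv, mul_comm k⁻¹, mul_assoc, inv_mul_cancel₀ hk.ne', mul_one]

theorem tang_eq_inner (γ : ℝ → Plane) (X : Plane) (s : ℝ) :
    tang γ X s = inner ℝ (unitVec (γ s) X) (deriv γ s) := by
  rw [tang, unitVec, inner_smul_left, conj_trivial, inv_mul_eq_div]

/-- The deviations at `p` and `q` of the line `pq` from the point `x` are proportional. -/
theorem deviation_identity {p q x S T : Plane} (hpq : p ≠ q) (hpx : p ≠ x) (hqx : q ≠ x) :
    inner ℝ (unitVec q x + unitVec p q) S *
        ((1 - inner ℝ (unitVec p q) (unitVec q x)) * dist q x *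
          cross (unitVec p q + unitVec p x) T) =
      inner ℝ (unitVec p x - unitVec p q) T *
        ((1 + inner ℝ (unitVec p q) (unitVec p x)) * dist p x *
          cross (unitVec p q - unitVec q x) S) := by
  have h1 := one_add_inner_mul_inner_sub (norm_unitVec hpq) (norm_unitVec hpx) T
  have h2 := one_add_inner_mul_inner_sub (norm_unitVec hpq) (v := -unitVec q x)
    (by rw [norm_neg, norm_unitVec hqx]) S
  have h3 : cross (unitVec p q) (unitVec p x) * dist p x =
      cross (unitVec p q) (unitVec q x) * dist q x := by
    have hx := dist_ne_zero.2 hpx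
    have hy := dist_ne_zero.2 hqx
    simp only [unitVec, cross_smul]
    field_simp
    simp only [cross, PiLp.sub_apply]
    ring
  have h4 : inner ℝ (unitVec q x + unitVec p q) S = -inner ℝ (-unitVec q x - unitVec p q) S := by
    rw [← inner_neg_left]
    congr 1
    abel
  have h5 : cross (unitVec p q) (-unitVec q x) = -cross (unitVec p q) (unitVec q x) := by
    simp only [cross, PiLp.neg_apply]
    ring
  rw [inner_neg_right, ← sub_eq_add_neg, ← sub_eq_add_neg, h5] at h2
  rw [h4]
  linear_combination (-dist q x * cross (unitVec p q + unitVec p x) T) * h2 -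
    dist p x * cross (unitVec p q - unitVec q x) S * h1 -
    cross (unitVec p q + unitVec p x) T * cross (unitVec p q - unitVec q x) S * h3

/-! ### Constant sum of distances and the ellipse -/

section Domain

variable {Ω : Set Plane} {γ : ℝ → Plane} {L : ℝ}

theorem abs_cross_unitVec {C : Set Plane} (hγ : IsAnalyticUnitSpeedParam γ L C) {p q : Plane}
    {s : ℝ} (hpq : p ≠ q) (h0 : inner ℝ (p - q) (deriv γ s) = 0) :
    |cross (unitVec p q) (deriv γ s)| = 1 := by
  have h := cross_sq_add_inner_sq (unitVec p q) (deriv γ s)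
  rw [norm_unitVec hpq, hγ.unit_speed, unitVec, inner_smul_left, h0, ← unitVec] at h
  have h1 : cross (unitVec p q) (deriv γ s) ^ 2 = 1 := by simpa using h
  exact (sq_eq_sq₀ (abs_nonneg _) one_pos.le).1 (by rw [sq_abs, h1, one_pow])

/-- How the reflection map of the focal point `c` scales the derivative of the sum of the
distances to `c` and to another point `x` of a double normal through `c`. -/
theorem IsFocal.exists_scaling (hΩ : IsStrictlyConvexDomain Ω)
    (hγ : IsAnalyticUnitSpeedParam γ L (frontier Ω)) {c x : Plane} (hc : c ∈ Ω) (hx : x ∈ Ω)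
    (hf : IsFocal γ c) {α β l : ℝ} (hd : IsDoubleNormal γ α β) (hl0 : 0 < l) (hl1 : l < 1)
    (hl : γ α - x = l • (γ α - γ β)) {σ : ℝ → ℝ} (hσα : σ α = β) (hσc : ContinuousAt σ α)
    (hσ : ∀ s, ReflectsInto γ c s (σ s)) :
    ∃ X Y : ℝ → ℝ, ContinuousAt X α ∧ ContinuousAt Y α ∧
      |X α| = 4 * (1 - l) * dist (γ α) (γ β) ∧ |Y α| = 4 * l * dist (γ α) (γ β) ∧
      ∀ s, (tang γ c (σ s) + tang γ x (σ s)) * X s = (tang γ c s + tang γ x s) * Y s := by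
  have hxn := ne_of_mem_domain hΩ hγ hx
  have hll : 0 < 1 - l := by linarith
  have hl' : γ β - x = (1 - l) • (γ β - γ α) := by
    have : γ β - x = (γ α - x) - (γ α - γ β) := by abel
    rw [this, hl]; module
  have hne : ∀ s, γ s ≠ γ (σ s) := fun s => (hσ s).ne hΩ hγ hc
  have c1 : ContinuousAt γ α := hγ.continuous.continuousAt
  have c2 : ContinuousAt (fun s => γ (σ s)) α := hγ.continuous.continuousAt.comp hσc
  have c3 : ContinuousAt (deriv γ) α := (hγ.hasDerivAt_deriv α).continuousAt
  have c4 : ContinuousAt (fun s => deriv γ (σ s)) α :=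
    (hγ.hasDerivAt_deriv (σ α)).continuousAt.comp hσc
  have c5 : ContinuousAt (fun s => unitVec (γ s) (γ (σ s))) α := continuousAt_unitVec c1 c2 (hne α)
  have c6 : ContinuousAt (fun s => unitVec (γ s) x) α :=
    continuousAt_unitVec c1 continuousAt_const (hxn α)
  have c7 : ContinuousAt (fun s => unitVec (γ (σ s)) x) α :=
    continuousAt_unitVec c2 continuousAt_const (hxn _)
  have hu : inner ℝ (unitVec (γ α) (γ β)) (unitVec (γ α) (γ β)) = 1 := by
    rw [real_inner_self_eq_norm_sq, norm_unitVec hd.ne, one_pow]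
  have e1 : unitVec (γ α) x = unitVec (γ α) (γ β) := unitVec_eq_of_smul hl0 hl
  have e2 : unitVec (γ β) x = -unitVec (γ α) (γ β) := by
    rw [unitVec_eq_of_smul hll hl', unitVec_comm]
  have e3 : dist (γ α) x = l * dist (γ α) (γ β) := by
    rw [dist_eq_norm, hl, norm_smul, Real.norm_of_nonneg hl0.le, dist_eq_norm]
  have e4 : dist (γ β) x = (1 - l) * dist (γ α) (γ β) := by
    rw [dist_eq_norm, hl', norm_smul, Real.norm_of_nonneg hll.le, dist_comm, dist_eq_norm]
  have hcr : ∀ v T : Plane, |cross (v + v) T| = 2 * |cross v T| := by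
    intro v T
    have : cross (v + v) T = 2 * cross v T := by simp only [cross, PiLp.add_apply]; ring
    rw [this, abs_mul, abs_two]
  have hr : inner ℝ (γ α - γ β) (deriv γ β) = 0 := by
    rw [← neg_sub, inner_neg_left, hd.right, neg_zero]
  -- The factors of `deviation_identity` for `p = γ s`, `q = γ (σ s)`. At `α` all directions are
  -- along the chord, so the inner product and cross product factors each contribute `2` in absolute
  -- value.
  refine ⟨fun s => (1 - inner ℝ (unitVec (γ s) (γ (σ s))) (unitVec (γ (σ s)) x)) *
      dist (γ (σ s)) x * cross (unitVec (γ s) (γ (σ s)) + unitVec (γ s) x) (deriv γ s),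
    fun s => (1 + inner ℝ (unitVec (γ s) (γ (σ s))) (unitVec (γ s) x)) * dist (γ s) x *
      cross (unitVec (γ s) (γ (σ s)) - unitVec (γ (σ s)) x) (deriv γ (σ s)), ?_, ?_, ?_, ?_, ?_⟩
  · exact ((continuousAt_const.sub (c5.inner (𝕜 := ℝ) c7)).mul (c2.dist continuousAt_const)).mul
      (continuousAt_cross (c5.add c6) c3)
  · exact ((continuousAt_const.add (c5.inner (𝕜 := ℝ) c6)).mul (c1.dist continuousAt_const)).mul
      (continuousAt_cross (c5.sub c7) c4)
  · simp only [hσα, e1, e2, e4]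
    rw [inner_neg_right, hu, abs_mul, hcr, abs_cross_unitVec hγ hd.ne hd.left,
      abs_of_nonneg (by have := dist_nonneg (x := γ α) (y := γ β); norm_num; positivity)]
    ring
  · simp only [hσα, e1, e2, e3]
    rw [sub_neg_eq_add, hu, abs_mul, hcr, abs_cross_unitVec hγ hd.ne hr,
      abs_of_nonneg (by positivity)]
    ring
  · intro s
    have h1 := deviation_identity (S := deriv γ (σ s)) (T := deriv γ s) (hne s) (hxn s)
      (hxn (σ s))
    have h2 := (hσ s).tang_add_tang hγ
    have h3 := hf.tang_add_tang hΩ hγ hc (hσ s)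
    -- The reflection laws replace the direction to `c` by that of the chord, turning the sum into
    -- the deviation of the chord from `x`.
    have h4 : tang γ c (σ s) + tang γ x (σ s) =
        inner ℝ (unitVec (γ (σ s)) x + unitVec (γ s) (γ (σ s))) (deriv γ (σ s)) := by
      rw [tang_eq_inner γ (γ s), unitVec_comm, inner_neg_left] at h3
      rw [inner_add_left, ← tang_eq_inner]
      linarith
    have h5 : tang γ c s + tang γ x s =
        inner ℝ (unitVec (γ s) x - unitVec (γ s) (γ (σ s))) (deriv γ s) := by
      rw [inner_sub_left, ← tang_eq_inner, ← tang_eq_inner]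
      linarith
    rw [h4, h5]
    exact h1

/-- Two focal points, one of them of the second kind, have constant sum of distances to the
boundary. -/
theorem dist_add_dist_const (hΩ : IsStrictlyConvexDomain Ω)
    (hγ : IsAnalyticUnitSpeedParam γ L (frontier Ω)) {c c' : Plane} (hc : c ∈ Ω) (hc' : c' ∈ Ω)
    (hf : IsFocal γ c) (hf' : IsFocal γ c') (hs : IsSecondKind γ c) (hne : c ≠ c') :
    ∃ ℓ : ℝ, ∀ s, dist (γ s) c + dist (γ s) c' = ℓ := by
  obtain ⟨α, β, hd, hcm, hxm⟩ := exists_isDoubleNormal hΩ hγ hc hc' hf hf' hne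
  obtain ⟨k, l, hkl, hk0, hk1, hk, hl0, hl1, hl⟩ := exists_smul_pair hcm hxm hne
  obtain ⟨hu, -⟩ := IsSecondKind.conjugate hΩ hγ hc hc' hf hf' hs hd hk0 hk1 hk hl0 hl1 hl hkl
  have hkk : 0 < 1 - k := by linarith
  have hll : 0 < 1 - l := by linarith
  have hℓ : 0 < dist (γ α) (γ β) := dist_pos.2 hd.ne
  have swap : ∀ (y : Plane) (r : ℝ), γ α - y = r • (γ α - γ β) →
      γ β - y = (1 - r) • (γ β - γ α) := by
    intro y r h
    have : γ β - y = (γ α - y) - (γ α - γ β) := by abel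
    rw [this, h]; module
  obtain ⟨-, σ, x, hσα, hσ', hxa, hσ⟩ := hf.linearization hΩ hγ hc hd hk0 hk1 hk
  obtain ⟨hpq, τ, y, hτβ, hτ', hya, hτ⟩ :=
    hf'.linearization hΩ hγ hc' hd.symm hll (by linarith) (swap _ _ hl)
  obtain ⟨X₁, Y₁, hX₁, hY₁, hX₁a, hY₁a, h₁⟩ :=
    hf.exists_scaling hΩ hγ hc hc' hd hl0 hl1 hl hσα hσ'.continuousAt hσ
  obtain ⟨X₂, Y₂, hX₂, hY₂, hX₂a, hY₂a, h₂⟩ := hf'.exists_scaling hΩ hγ hc' hc hd.symm hkk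
    (by linarith) (swap _ _ hk) hτβ hτ'.continuousAt hτ
  have hcn := ne_of_mem_domain hΩ hγ hc
  have hcn' := ne_of_mem_domain hΩ hγ hc'
  have han : ∀ s, AnalyticAt ℝ (fun s => dist (γ s) c + dist (γ s) c') s := fun s =>
    (hγ.analyticAt_dist (hcn s)).add (hγ.analyticAt_dist (hcn' s))
  have hder : deriv (fun s => dist (γ s) c + dist (γ s) c') = fun s => tang γ c s + tang γ c' s :=
    funext fun s => ((hγ.hasDerivAt_dist (hcn s)).add (hγ.hasDerivAt_dist (hcn' s))).deriv
  have hDan : ∀ s, AnalyticAt ℝ (fun s => tang γ c s + tang γ c' s) s := fun s =>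
    hder ▸ (han s).deriv
  -- By conjugacy `k⁻¹ + normalParam γ α β = 1 - l⁻¹`.
  have hxv : |x| = (1 - l) / l := by
    have : k⁻¹ + normalParam γ α β = -((1 - l) / l) := by
      rw [eq_sub_iff_add_eq] at hu
      field_simp at hu ⊢
      linarith
    rw [hxa, this, abs_neg, abs_of_pos (by positivity)]
  have hyv : |y| = k / (1 - k) := by
    have e1 : (1 - (1 - l))⁻¹ + normalParam γ α β = -((1 - k) / k) := by
      rw [sub_sub_cancel]
      rw [eq_sub_iff_add_eq] at hu
      field_simp at hu ⊢
      linarith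
    rw [e1] at hpq
    -- The mirror equation `hpq` of `c'` makes this the inverse of the value in `e1`.
    have e2 : (1 - l)⁻¹ + normalParam γ β α = -(k / (1 - k)) := by
      field_simp at hpq ⊢
      linarith
    rw [hya, e2, abs_neg, abs_of_pos (by positivity)]
  have hzero : ∀ᶠ s in 𝓝 α, tang γ c s + tang γ c' s = 0 := by
    -- The round trip `τ ∘ σ` fixes `α`; its multiplier has absolute value `k (1 - l) / (l (1 -
    -- k))`, which is `1` only if `k = l`.
    have hcomp : HasDerivAt (fun s => τ (σ s)) (y * x) α := by
      rw [← hσα] at hτ'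
      exact hτ'.comp α hσ'
    have hcX : ContinuousAt (fun s => X₂ (σ s)) α := by
      rw [← hσα] at hX₂
      exact ContinuousAt.comp (g := X₂) hX₂ hσ'.continuousAt
    have hcY : ContinuousAt (fun s => Y₂ (σ s)) α := by
      rw [← hσα] at hY₂
      exact ContinuousAt.comp (g := Y₂) hY₂ hσ'.continuousAt
    rw [dist_comm] at hX₂a hY₂a
    rw [sub_sub_cancel] at hX₂a
    refine eventually_eq_zero_of_scaling (hDan α) hcomp (by rw [hσα, hτβ]) (hX₁.mul hcX)
      (hY₁.mul hcY) (fun s => ?_) ?_ ?_ ?_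
    · simp only [Pi.mul_apply]
      linear_combination X₁ s * h₂ (σ s) + Y₂ (σ s) * h₁ s
    · simp only [Pi.mul_apply, hσα]
      rw [abs_mul, abs_mul, abs_mul, hxv, hyv, hX₁a, hY₁a, hX₂a, hY₂a]
      field_simp
    · simp only [Pi.mul_apply, hσα]
      rw [← abs_ne_zero, abs_mul, hX₁a, hX₂a]
      positivity
    · rw [abs_mul, hxv, hyv]
      intro h
      apply hkl
      field_simp at h
      linarith
  have hD0 := AnalyticOnNhd.eq_of_eventuallyEq (𝕜 := ℝ) (g := fun _ => (0 : ℝ))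
    (fun s _ => hDan s) (fun _ _ => analyticAt_const) hzero
  refine ⟨_, fun s => is_const_of_deriv_eq_zero (f := fun s => dist (γ s) c + dist (γ s) c')
    (fun s => (han s).differentiableAt) (fun s => ?_) s α⟩
  rw [hder]
  exact congrFun hD0 s

/-- The boundary lies on the ellipse by hypothesis. Conversely, a ray from `c` meets the ellipse at
most once, by convexity of the sum of distances and `dist c c' < ℓ`, and it does meet the boundary.
-/
theorem isEllipseWithFoci_of_const (hΩ : IsStrictlyConvexDomain Ω)
    (hγ : IsAnalyticUnitSpeedParam γ L (frontier Ω)) {c c' : Plane} (hc : c ∈ Ω) (hc' : c' ∈ Ω)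
    {ℓ : ℝ} (h : ∀ s, dist (γ s) c + dist (γ s) c' = ℓ) :
    IsEllipseWithFoci (frontier Ω) c c' := by
  have hlt : dist c c' < ℓ := by
    rw [← h 0]
    refine lt_of_le_of_ne (by rw [dist_comm (γ 0) c]; exact dist_triangle _ _ _) fun he => ?_
    have h1 : dist c (γ 0) + dist (γ 0) c' = dist c c' := by rw [he, dist_comm c]
    exact hΩ.notMem_of_mem_frontier (hγ.mem 0)
      (hΩ.convex.segment_subset hc hc' (dist_add_dist_eq_iff.1 h1).mem_segment)
  have hF : ∀ y ∈ frontier Ω, dist y c + dist y c' = ℓ := by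
    intro y hy
    obtain ⟨s, rfl⟩ : y ∈ range γ := hγ.range_eq ▸ hy
    exact h s
  have hseg : ∀ y z : Plane, dist y c + dist y c' = ℓ → z ∈ openSegment ℝ c y →
      dist z c + dist z c' < ℓ := by
    rintro y _ hy ⟨a, b, ha, hb, hab, rfl⟩
    have h1 := (convexOn_univ_dist c).2 (mem_univ c) (mem_univ y) ha.le hb.le hab
    have h2 := (convexOn_univ_dist c').2 (mem_univ c) (mem_univ y) ha.le hb.le hab
    simp only [dist_self, smul_eq_mul, mul_zero, zero_add] at h1 h2
    have h3 : a * dist c c' < a * ℓ := mul_lt_mul_of_pos_left hlt ha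
    have h4 : a * ℓ + b * ℓ = ℓ := by rw [← add_mul, hab, one_mul]
    have h5 : b * dist y c + b * dist y c' = b * ℓ := by rw [← mul_add, hy]
    linarith
  refine ⟨ℓ, hlt, Subset.antisymm hF fun x hx => ?_⟩
  have hxc : x - c ≠ 0 := by
    intro h0
    rw [sub_eq_zero] at h0
    simp only [mem_ofPred_eq, h0, dist_self, zero_add] at hx
    exact hlt.ne hx
  obtain ⟨t, ht, hy⟩ := hΩ.exists_frontier_ray hc hxc
  have hx1 : c + (1 : ℝ) • (x - c) = x := by module
  rcases lt_trichotomy t 1 with h1 | h1 | h1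
  · have := hseg x _ hx (hx1 ▸ add_smul_mem_openSegment (p := c) (w := x - c) ht h1)
    exact absurd (hF _ hy) this.ne
  · rwa [h1, hx1] at hy
  · have := hseg _ x (hF _ hy) (by
      have := add_smul_mem_openSegment (p := c) (w := x - c) one_pos h1
      rwa [hx1] at this)
    exact absurd hx this.ne

end Domain

end Billiard

theorem theorem4p1 (Ω : Set Billiard.Plane) (hΩ : Billiard.IsStrictlyConvexDomain Ω)
    (γ : ℝ → Billiard.Plane) (L : ℝ)
    (hγ : Billiard.IsAnalyticUnitSpeedParam γ L (frontier Ω)) :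
    (Billiard.focalPointsSecondKind Ω γ).encard ≤ 2 ∧
    ((Billiard.focalPointsSecondKind Ω γ).encard = 2 →
      ∃ f₁ f₂ : Billiard.Plane, f₁ ≠ f₂ ∧
        Billiard.IsEllipseWithFoci (frontier Ω) f₁ f₂ ∧
        Billiard.focalPointsSecondKind Ω γ = {f₁, f₂}) := by
  refine ⟨?_, fun h => ?_⟩
  · by_contra hcon
    obtain ⟨S, hS, hS3⟩ := Set.exists_subset_encard_eq (k := 3)
      (by simpa [two_add_one_eq_three] using Order.add_one_le_of_lt (not_le.1 hcon))
    obtain ⟨c, x, y, hcx, hcy, hxy, rfl⟩ := Set.encard_eq_three.1 hS3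
    obtain ⟨hc, hfc, hs⟩ : c ∈ Billiard.focalPointsSecondKind Ω γ := hS (by simp)
    obtain ⟨hx, hfx, -⟩ : x ∈ Billiard.focalPointsSecondKind Ω γ := hS (by simp)
    obtain ⟨hy, hfy, -⟩ : y ∈ Billiard.focalPointsSecondKind Ω γ := hS (by simp)
    exact hxy (Billiard.not_three_focal hΩ hγ hc hx hy hfc hfx hfy hs hcx hcy)
  · obtain ⟨c, c', hne, he⟩ := Set.encard_eq_two.1 h
    obtain ⟨hc, hf, hs⟩ : c ∈ Billiard.focalPointsSecondKind Ω γ := by rw [he]; simp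
    obtain ⟨hc', hf', -⟩ : c' ∈ Billiard.focalPointsSecondKind Ω γ := by rw [he]; simp
    obtain ⟨ℓ, hℓ⟩ := Billiard.dist_add_dist_const hΩ hγ hc hc' hf hf' hs hne
    exact ⟨c, c', hne, Billiard.isEllipseWithFoci_of_const hΩ hγ hc hc' hℓ, he⟩
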